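/- Let $d\ge 1$ and let $\omega:[0,\infty)\to[0,\infty)$ be a non-quasianalytic weight function in the sense of Braun, Meise and Taylor, i.e. $\omega$ is increasing (in the weak sense) and continuous and satisfies: $(\alpha)$ there is $L\ge 1$ with $\omega(2t)\le L\omega(t)+L$ for all $t\ge 0$; $(\beta)$ $\int_1^\infty \frac{\omega(t)}{1+t^2}\,dt<\infty$; $(\gamma)$ $\log t=O(\omega(t))$ as $t\to\infty$; $(\delta)$ $t\mapsto\omega(e^t)$ is convex on $\mathbb{R}$. Write $\omega(x)=\omega(|x|)$ for $x\in\mathbb{R}^d$ and $\widehat f(\xi)=\int_{\mathbb{R}^d}e^{-it\cdot\xi}f(t)\,dt$. Let $\mathcal{S}_\omega(\mathbb{R}^d)$ be the space of all $f\in L^1(\mathbb{R}^d)$ with $f,\widehat f\in C^\infty(\mathbb{R}^d)$ such that, for all $\lambda>0$ and $\alpha\in\mathbb{N}_0^d$, $$\sup_{x\in\mathbb{R}^d}|D^\alpha f(x)|e^{\lambda\omega(x)}<\infty\quad\text{and}\quad \sup_{\xi\in\mathbb{R}^d}|D^\alpha\widehat f(\xi)|e^{\lambda\omega(\xi)}<\infty,$$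 with the locally convex topology given by these seminorms, and let $\mathcal{S}_\omega'(\mathbb{R}^d)$ be its topological dual. For $a\in\mathcal{S}_\omega'(\mathbb{R}^d)$ and $f\in\mathcal{S}_\omega(\mathbb{R}^d)$ let $af\in\mathcal{S}'_\omega(\mathbb{R}^d)$ be given by $\langle af,h\rangle=\langle a,fh\rangle$, and regard $g\in\mathcal{S}_\omega(\mathbb{R}^d)$ as the element $h\mapsto\int gh$ of $\mathcal{S}_\omega'(\mathbb{R}^d)$; for a function $a:\mathbb{R}^d\to\mathbb{C}$ let $af$ be the pointwise product. In both cases $\mathcal{M}_a f:=af$. A linear operator $T$ from a Hausdorff locally convex space into itself is compact if it maps some neighbourhood of $0$ to a relatively compact set. Then, for every $a\in\mathcal{S}_\omega'(\mathbb{R}^d)$, and likewise for every function $a:\mathbb{R}^d\to\mathbb{C}$, the multiplication operator $\mathcal{M}_a$ maps $\mathcal{S}_\omega(\mathbb{R}^d)$ into itself and is compact as an operator $\mathcal{S}_\omega(\mathbb{R}^d)\to\mathcal{S}_\omega(\mathbb{R}^d)$ if and only if $a=0$. The same holds with the Schwartz space $\mathcal{S}(\mathbb{R}^d)$ and its dual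 $\mathcal{S}'(\mathbb{R}^d)$ in place of $\mathcal{S}_\omega(\mathbb{R}^d)$ and $\mathcal{S}_\omega'(\mathbb{R}^d)$. -/

import Mathlib

open MeasureTheory Filter Set
open scoped FourierTransform SchwartzMap

/-- A non-quasianalytic weight function in the sense of Braun, Meise and Taylor. Only the values on
`[0, ∞)` matter. -/
structure WeightFunction where
  toFun : ℝ → ℝ
  nonneg : ∀ t, 0 ≤ t → 0 ≤ toFun t
  monotoneOn : MonotoneOn toFun (Ici 0)
  continuousOn : ContinuousOn toFun (Ici 0)
  /-- condition `(α)` -/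
  doubling : ∃ L : ℝ, 1 ≤ L ∧ ∀ t, 0 ≤ t → toFun (2 * t) ≤ L * toFun t + L
  /-- condition `(β)` -/
  integrableOn : IntegrableOn (fun t => toFun t / (1 + t ^ 2)) (Ioi 1)
  /-- condition `(γ)` -/
  log_isBigO : Real.log =O[atTop] toFun
  /-- condition `(δ)` -/
  convexOn : ConvexOn ℝ univ (fun t => toFun (Real.exp t))

namespace WeightFunction

instance : CoeFun WeightFunction (fun _ => ℝ → ℝ) := ⟨toFun⟩

theorem add_le (ω : WeightFunction) : ∃ L : ℝ, 1 ≤ L ∧ ∀ s t, 0 ≤ s → 0 ≤ t →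
    ω (s + t) ≤ L * (ω s + ω t) + L := by
  obtain ⟨L, hL, h⟩ := ω.doubling
  refine ⟨L, hL, fun s t hs ht => ?_⟩
  have key : ∀ s t, 0 ≤ s → s ≤ t → ω (s + t) ≤ L * (ω s + ω t) + L := by
    intro s t hs hst
    have ht := hs.trans hst
    have h1 := ω.monotoneOn (a := s + t) (b := 2 * t) (by simp; linarith) (by simp; linarith)
      (by linarith)
    have h2 := h t ht
    have h3 := mul_nonneg (by linarith : 0 ≤ L) (ω.nonneg s hs)
    linarith [mul_add L (ω s) (ω t)]
  rcases le_total s t with hst | hst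
  · exact key s t hs hst
  · have := key t s ht hst
    rwa [add_comm t s, add_comm (ω t) (ω s)] at this

theorem log_le (ω : WeightFunction) : ∃ A K : ℝ, 0 < K ∧ ∀ t, 0 ≤ t →
    Real.log (1 + t) ≤ A + K * ω t := by
  obtain ⟨K, hK, h⟩ := ω.log_isBigO.exists_pos
  obtain ⟨T, hT⟩ := (eventually_atTop.1 h.bound)
  set T' := max T 1
  refine ⟨Real.log 2 + Real.log (1 + T'), K, hK, fun t ht => ?_⟩
  have hω := ω.nonneg t ht
  have hT1 : 1 ≤ T' := le_max_right _ _
  have hl2 : 0 ≤ Real.log 2 := Real.log_nonneg (by norm_num)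
  have hlT : 0 ≤ Real.log (1 + T') := Real.log_nonneg (by linarith)
  rcases le_total T' t with htT | htT
  · have h1 := hT t ((le_max_left _ _).trans htT)
    rw [Real.norm_eq_abs, Real.norm_eq_abs, abs_of_nonneg hω] at h1
    have h2 : Real.log (1 + t) ≤ Real.log (2 * t) :=
      Real.log_le_log (by linarith) (by linarith)
    rw [Real.log_mul (by norm_num) (by linarith)] at h2
    linarith [le_abs_self (Real.log t)]
  · have h2 : Real.log (1 + t) ≤ Real.log (1 + T') :=
      Real.log_le_log (by linarith) (by linarith)
    nlinarith [mul_nonneg hK.le hω]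

theorem continuous_norm (ω : WeightFunction) {X V : Type*} [TopologicalSpace X]
    [SeminormedAddCommGroup V] {u : X → V} (hu : Continuous u) :
    Continuous fun x => ω ‖u x‖ :=
  ω.continuousOn.comp_continuous hu.norm fun _ => norm_nonneg _

end WeightFunction

noncomputable section

namespace BMT

/-- The Fourier transform `ξ ↦ ∫ e^{-i t·ξ} f(t) dt`. -/
def fourier {d : ℕ} (f : EuclideanSpace ℝ (Fin d) → ℂ) (ξ : EuclideanSpace ℝ (Fin d)) : ℂ :=
  ∫ t, Complex.exp (-Complex.I * (inner ℝ t ξ : ℝ)) * f t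

/-- `x ↦ |D^k u(x)| e^{λ ω(x)}`, where `|D^k u(x)|` is the norm of the full `k`-th derivative, which
is equivalent to the maximum of the partial derivatives of order `k`. -/
def weighted {d : ℕ} (ω : WeightFunction) (l : ℝ) (k : ℕ) (u : EuclideanSpace ℝ (Fin d) → ℂ)
    (x : EuclideanSpace ℝ (Fin d)) : ℝ :=
  ‖iteratedFDeriv ℝ k u x‖ * Real.exp (l * ω ‖x‖)

/-- Smoothness together with finiteness of all the suprema of `|D^k u(x)| e^{λ ω(x)}`. -/
def Decays {d : ℕ} (ω : WeightFunction) (u : EuclideanSpace ℝ (Fin d) → ℂ) : Prop :=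
  ContDiff ℝ (⊤ : ℕ∞) u ∧ ∀ l : ℝ, 0 < l → ∀ k : ℕ, BddAbove (range (weighted ω l k u))

section basic

variable {d : ℕ} {ω : WeightFunction} {u v : EuclideanSpace ℝ (Fin d) → ℂ}

theorem weighted_nonneg (l : ℝ) (k : ℕ) (x : EuclideanSpace ℝ (Fin d)) :
    0 ≤ weighted ω l k u x := by
  unfold weighted; positivity

theorem weighted_zero (l : ℝ) (k : ℕ) (x : EuclideanSpace ℝ (Fin d)) :
    weighted ω l k 0 x = 0 := by
  unfold weighted
  simp

theorem weighted_add (hu : ContDiff ℝ (⊤ : ℕ∞) u) (hv : ContDiff ℝ (⊤ : ℕ∞) v) (l : ℝ) (k : ℕ)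
    (x : EuclideanSpace ℝ (Fin d)) :
    weighted ω l k (u + v) x ≤ weighted ω l k u x + weighted ω l k v x := by
  unfold weighted
  rw [iteratedFDeriv_add (hu.of_le (by exact_mod_cast le_top)) (hv.of_le (by exact_mod_cast le_top)),
    ← add_mul]
  gcongr
  exact norm_add_le _ _

theorem weighted_smul (hu : ContDiff ℝ (⊤ : ℕ∞) u) (c : ℂ) (l : ℝ) (k : ℕ)
    (x : EuclideanSpace ℝ (Fin d)) :
    weighted ω l k (c • u) x = ‖c‖ * weighted ω l k u x := by
  unfold weighted
  rw [iteratedFDeriv_const_smul_apply (hu.contDiffAt.of_le (by exact_mod_cast le_top)), norm_smul,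
    mul_assoc]

theorem Decays.zero : Decays ω (0 : EuclideanSpace ℝ (Fin d) → ℂ) :=
  ⟨contDiff_const, fun l _ k => ⟨0, by rintro _ ⟨x, rfl⟩; exact (weighted_zero l k x).le⟩⟩

theorem Decays.add (hu : Decays ω u) (hv : Decays ω v) : Decays ω (u + v) := by
  refine ⟨hu.1.add hv.1, fun l hl k => ?_⟩
  obtain ⟨A, hA⟩ := hu.2 l hl k
  obtain ⟨B, hB⟩ := hv.2 l hl k
  refine ⟨A + B, ?_⟩
  rintro _ ⟨x, rfl⟩
  exact (weighted_add hu.1 hv.1 l k x).trans (add_le_add (hA ⟨x, rfl⟩) (hB ⟨x, rfl⟩))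

theorem Decays.smul (c : ℂ) (hu : Decays ω u) : Decays ω (c • u) := by
  refine ⟨hu.1.const_smul c, fun l hl k => ?_⟩
  obtain ⟨A, hA⟩ := hu.2 l hl k
  refine ⟨‖c‖ * A, ?_⟩
  rintro _ ⟨x, rfl⟩
  rw [weighted_smul hu.1]
  exact mul_le_mul_of_nonneg_left (hA ⟨x, rfl⟩) (norm_nonneg c)

theorem integrable_fourier_integrand (hu : Integrable u) (ξ : EuclideanSpace ℝ (Fin d)) :
    Integrable fun t => Complex.exp (-Complex.I * (inner ℝ t ξ : ℝ)) * u t := by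
  refine hu.bdd_mul (c := 1) (Continuous.aestronglyMeasurable (by fun_prop)) (ae_of_all _ fun t => ?_)
  simp [Complex.norm_exp]

theorem fourier_zero : fourier (0 : EuclideanSpace ℝ (Fin d) → ℂ) = 0 := by
  ext ξ; simp [fourier]

theorem fourier_add (hu : Integrable u) (hv : Integrable v) :
    fourier (u + v) = fourier u + fourier v := by
  ext ξ
  simp only [fourier, Pi.add_apply, mul_add]
  exact integral_add (integrable_fourier_integrand hu ξ) (integrable_fourier_integrand hv ξ)

theorem fourier_smul (c : ℂ) : fourier (c • u) = c • fourier u := by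
  ext ξ
  simp only [fourier, Pi.smul_apply, smul_eq_mul, ← integral_const_mul]
  congr 1; ext t; ring

end basic

/-- The functions that belong to `𝓢_ω(ℝ^d)`. -/
def sOmega (ω : WeightFunction) (d : ℕ) : Submodule ℂ (EuclideanSpace ℝ (Fin d) → ℂ) where
  carrier := {f | Integrable f ∧ Decays ω f ∧ Decays ω (fourier f)}
  zero_mem' := ⟨integrable_zero _ _ _, Decays.zero, by rw [fourier_zero]; exact Decays.zero⟩
  add_mem' := by
    rintro f g ⟨h1, h2, h3⟩ ⟨h1', h2', h3'⟩
    exact ⟨h1.add h1', h2.add h2', by rw [fourier_add h1 h1']; exact h3.add h3'⟩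
  smul_mem' := by
    rintro c f ⟨h1, h2, h3⟩
    exact ⟨h1.smul c, h2.smul c, by rw [fourier_smul]; exact h3.smul c⟩

/-- The space `𝓢_ω(ℝ^d)`. It is a type of its own, so that it does not inherit the topology of
pointwise convergence. -/
def SOmega (ω : WeightFunction) (d : ℕ) : Type := sOmega ω d

namespace SOmega

variable {ω : WeightFunction} {d : ℕ}

instance : AddCommGroup (SOmega ω d) := inferInstanceAs (AddCommGroup (sOmega ω d))

instance : Module ℂ (SOmega ω d) := inferInstanceAs (Module ℂ (sOmega ω d))

instance : FunLike (SOmega ω d) (EuclideanSpace ℝ (Fin d)) ℂ where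
  coe f := f.1
  coe_injective _ _ h := Subtype.ext h

theorem mem (f : SOmega ω d) : (f : EuclideanSpace ℝ (Fin d) → ℂ) ∈ sOmega ω d := f.2

theorem integrable (f : SOmega ω d) : Integrable f := f.2.1

theorem decays (f : SOmega ω d) : Decays ω f := f.2.2.1

theorem decays_fourier (f : SOmega ω d) : Decays ω (fourier f) := f.2.2.2

theorem coe_add (f g : SOmega ω d) : ⇑(f + g) = f + g := rfl

theorem coe_smul (c : ℂ) (f : SOmega ω d) : ⇑(c • f) = c • ⇑f := rfl

/-- The seminorm `f ↦ sup_x |D^k (A f)(x)| e^{λ ω(x)}` for a linear `A` with values in the functions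
satisfying `Decays ω`. -/
def seminormOf (A : SOmega ω d →ₗ[ℂ] (EuclideanSpace ℝ (Fin d) → ℂ)) (hA : ∀ f, Decays ω (A f))
    (l : {l : ℝ // 0 < l}) (k : ℕ) : Seminorm ℂ (SOmega ω d) :=
  Seminorm.of (fun f => ⨆ x, weighted ω l k (A f) x)
    (fun f g => by
      refine ciSup_le fun x => ?_
      rw [map_add]
      exact (weighted_add (hA f).1 (hA g).1 l k x).trans (add_le_add
        (le_ciSup ((hA f).2 l l.2 k) x) (le_ciSup ((hA g).2 l l.2 k) x)))
    (fun c f => by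
      simp only [map_smul, weighted_smul (hA f).1]
      exact (Real.mul_iSup_of_nonneg (norm_nonneg c) _).symm)

/-- `f ↦ sup_x |D^k f(x)| e^{λ ω(x)}` -/
def p : {l : ℝ // 0 < l} → ℕ → Seminorm ℂ (SOmega ω d) :=
  seminormOf { toFun := fun f => f, map_add' := coe_add, map_smul' := coe_smul } decays

/-- `f ↦ sup_ξ |D^k f̂(ξ)| e^{λ ω(ξ)}` -/
def q : {l : ℝ // 0 < l} → ℕ → Seminorm ℂ (SOmega ω d) :=
  seminormOf
    { toFun := fun f => fourier f
      map_add' := fun f g => fourier_add f.integrable g.integrable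
      map_smul' := fun _ _ => fourier_smul _ }
    decays_fourier

theorem p_apply (l : {l : ℝ // 0 < l}) (k : ℕ) (f : SOmega ω d) :
    p l k f = ⨆ x, ‖iteratedFDeriv ℝ k f x‖ * Real.exp (l * ω ‖x‖) := rfl

theorem q_apply (l : {l : ℝ // 0 < l}) (k : ℕ) (f : SOmega ω d) :
    q l k f = ⨆ ξ, ‖iteratedFDeriv ℝ k (fourier f) ξ‖ * Real.exp (l * ω ‖ξ‖) := rfl

/-- The defining family of seminorms of `𝓢_ω(ℝ^d)`. -/
def seminormFamily (ω : WeightFunction) (d : ℕ) :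
    SeminormFamily ℂ (SOmega ω d) (({l : ℝ // 0 < l} × ℕ) ⊕ ({l : ℝ // 0 < l} × ℕ)) :=
  Sum.elim (fun i => p i.1 i.2) (fun i => q i.1 i.2)

instance : TopologicalSpace (SOmega ω d) := (seminormFamily ω d).moduleFilterBasis.topology

theorem withSeminorms : WithSeminorms (seminormFamily ω d) := ⟨rfl⟩

instance : IsTopologicalAddGroup (SOmega ω d) :=
  withSeminorms.topologicalAddGroup

instance : ContinuousSMul ℂ (SOmega ω d) :=
  (seminormFamily ω d).moduleFilterBasis.continuousSMul

end SOmega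

/-! ### Products of elements of `𝓢_ω(ℝ^d)` -/

section product

variable {d : ℕ} {ω : WeightFunction}

theorem Decays.exists_bound {u : EuclideanSpace ℝ (Fin d) → ℂ} (hu : Decays ω u) {l : ℝ}
    (hl : 0 < l) (k : ℕ) :
    ∃ C : ℝ, 0 ≤ C ∧ ∀ x, ‖iteratedFDeriv ℝ k u x‖ ≤ C * Real.exp (-(l * ω ‖x‖)) := by
  obtain ⟨C, hC⟩ := hu.2 l hl k
  have h : ∀ x, ‖iteratedFDeriv ℝ k u x‖ * Real.exp (l * ω ‖x‖) ≤ C := fun x => hC ⟨x, rfl⟩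
  refine ⟨C, (by positivity : (0 : ℝ) ≤ _).trans (h 0), fun x => ?_⟩
  rw [Real.exp_neg, ← div_eq_mul_inv, le_div_iff₀ (Real.exp_pos _)]
  exact h x

theorem Decays.exists_bound' {u : EuclideanSpace ℝ (Fin d) → ℂ} (hu : Decays ω u) (k : ℕ) :
    ∃ C : ℝ, 0 ≤ C ∧ ∀ x, ‖iteratedFDeriv ℝ k u x‖ ≤ C := by
  obtain ⟨C, hC, h⟩ := hu.exists_bound one_pos k
  refine ⟨C, hC, fun x => (h x).trans (mul_le_of_le_one_right hC ?_)⟩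
  rw [Real.exp_le_one_iff]
  linarith [ω.nonneg _ (norm_nonneg x)]

theorem Decays.mul {u v : EuclideanSpace ℝ (Fin d) → ℂ} (hu : Decays ω u) (hv : Decays ω v) :
    Decays ω (fun x => u x * v x) := by
  refine ⟨hu.1.mul hv.1, fun l hl k => ?_⟩
  choose A hA0 hA using fun i => hu.exists_bound hl i
  choose B hB0 hB using fun i => hv.exists_bound' i
  refine ⟨∑ i ∈ Finset.range (k + 1), (k.choose i : ℝ) * A i * B (k - i), ?_⟩
  rintro _ ⟨x, rfl⟩
  have h := norm_iteratedFDeriv_mul_le (n := k) (N := ((⊤ : ℕ∞) : WithTop ℕ∞)) hu.1 hv.1 x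
    (by exact_mod_cast le_top)
  unfold weighted
  rw [← le_div_iff₀ (Real.exp_pos _), div_eq_mul_inv, ← Real.exp_neg, Finset.sum_mul]
  refine h.trans (Finset.sum_le_sum fun i _ => ?_)
  calc _ ≤ (k.choose i : ℝ) * (A i * Real.exp (-(l * ω ‖x‖))) * B (k - i) := by
        gcongr
        · exact mul_nonneg (Nat.cast_nonneg _) (mul_nonneg (hA0 i) (Real.exp_pos _).le)
        · exact hA i x
        · exact hB _ x
    _ = _ := by ring

/-- Functions of the decay `e^{-λ ω}` for all `λ` stay integrable against every `e^{M ω}`. -/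
theorem integrable_weighted {φ : EuclideanSpace ℝ (Fin d) → ℂ} (hφ : Continuous φ)
    (h : ∀ l : ℝ, 0 < l → ∃ C : ℝ, ∀ x, ‖φ x‖ ≤ C * Real.exp (-(l * ω ‖x‖))) (M : ℝ) :
    Integrable fun x => ‖φ x‖ * Real.exp (M * ω ‖x‖) := by
  obtain ⟨A, K, hK, hlog⟩ := ω.log_le
  set r : ℝ := d + 1
  have hr : 0 < r := by positivity
  set l := |M| + r * K
  have hl : 0 < l := by positivity
  obtain ⟨C, hC⟩ := h l hl
  have hC0 : 0 ≤ C := by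
    have := (norm_nonneg _).trans (hC 0)
    exact nonneg_of_mul_nonneg_left this (Real.exp_pos _)
  have hint : Integrable fun x : EuclideanSpace ℝ (Fin d) =>
      C * Real.exp (r * A) * (1 + ‖x‖) ^ (-r) := by
    refine (integrable_one_add_norm ?_).const_mul _
    simp [r]
  refine hint.mono' (Continuous.aestronglyMeasurable ?_) (ae_of_all _ fun x => ?_)
  · exact hφ.norm.mul (Real.continuous_exp.comp
      (continuous_const.mul (ω.continuous_norm continuous_id)))
  · rw [Real.norm_of_nonneg (by positivity)]
    have hx : 0 < 1 + ‖x‖ := by positivity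
    have hω := ω.nonneg _ (norm_nonneg x)
    rw [Real.rpow_def_of_pos hx, mul_assoc, ← Real.exp_add]
    calc ‖φ x‖ * Real.exp (M * ω ‖x‖)
        ≤ C * Real.exp (-(l * ω ‖x‖)) * Real.exp (M * ω ‖x‖) := by gcongr; exact hC x
      _ = C * Real.exp (-(l * ω ‖x‖) + M * ω ‖x‖) := by rw [mul_assoc, ← Real.exp_add]
      _ ≤ _ := by
        refine mul_le_mul_of_nonneg_left (Real.exp_le_exp.2 ?_) hC0
        have h1 := mul_le_mul_of_nonneg_left (hlog _ (norm_nonneg x)) hr.le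
        have h2 := mul_le_mul_of_nonneg_right (le_abs_self M) hω
        simp only [l]
        linear_combination h1 + h2

/-- Differentiation under the integral sign in `ξ ↦ ∫ φ(η) G(ξ - cη) dη`. -/
theorem iteratedFDeriv_conv {φ G : EuclideanSpace ℝ (Fin d) → ℂ} (c : ℝ) (hφ : Integrable φ)
    (hG : ContDiff ℝ (⊤ : ℕ∞) G) (hb : ∀ k : ℕ, ∃ C : ℝ, ∀ x, ‖iteratedFDeriv ℝ k G x‖ ≤ C) :
    ContDiff ℝ (⊤ : ℕ∞) (fun ξ => ∫ η, φ η * G (ξ - c • η)) ∧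
    ∀ (k : ℕ) (ξ : EuclideanSpace ℝ (Fin d)),
      iteratedFDeriv ℝ k (fun ξ => ∫ η, φ η * G (ξ - c • η)) ξ
        = ∫ η, φ η • iteratedFDeriv ℝ k G (ξ - c • η) := by
  have hcont : ∀ k : ℕ, Continuous (iteratedFDeriv ℝ k G) := fun k =>
    hG.continuous_iteratedFDeriv (by exact_mod_cast le_top)
  have hdiff : ∀ k : ℕ, Differentiable ℝ (iteratedFDeriv ℝ k G) := fun k =>
    hG.differentiable_iteratedFDeriv (by exact_mod_cast WithTop.coe_lt_top k)
  have hmeas : ∀ (k : ℕ) (ξ : EuclideanSpace ℝ (Fin d)),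
      AEStronglyMeasurable (fun η => φ η • iteratedFDeriv ℝ k G (ξ - c • η)) volume :=
    fun k ξ => hφ.aestronglyMeasurable.smul ((hcont k).comp (by fun_prop)).aestronglyMeasurable
  have hder : ∀ (k : ℕ) (ξ : EuclideanSpace ℝ (Fin d)),
      HasFDerivAt (fun ξ => ∫ η, φ η • iteratedFDeriv ℝ k G (ξ - c • η))
        (∫ η, φ η • fderiv ℝ (iteratedFDeriv ℝ k G) (ξ - c • η)) ξ := by
    intro k ξ
    obtain ⟨C, hC⟩ := hb k
    obtain ⟨C', hC'⟩ := hb (k + 1)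
    have hfd : ∀ y, fderiv ℝ (iteratedFDeriv ℝ k G) y
        = (continuousMultilinearCurryLeftEquiv ℝ
            (fun _ : Fin (k + 1) => EuclideanSpace ℝ (Fin d)) ℂ) (iteratedFDeriv ℝ (k + 1) G y) := by
      intro y
      rw [iteratedFDeriv_succ_eq_comp_left]
      exact ((continuousMultilinearCurryLeftEquiv ℝ
        (fun _ : Fin (k + 1) => EuclideanSpace ℝ (Fin d)) ℂ).apply_symm_apply _).symm
    refine hasFDerivAt_integral_of_dominated_of_fderiv_le (bound := fun η => ‖φ η‖ * C')
      (F' := fun ξ η => φ η • fderiv ℝ (iteratedFDeriv ℝ k G) (ξ - c • η)) univ_mem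
      (Eventually.of_forall fun ξ => ?_) ?_ ?_ ?_ (hφ.norm.mul_const _) ?_
    · exact hmeas k ξ
    · refine (hφ.norm.mul_const C).mono' (hmeas k ξ) (ae_of_all _ fun η => ?_)
      rw [norm_smul]
      gcongr
      exact hC _
    · have h := (LinearIsometryEquiv.continuous (continuousMultilinearCurryLeftEquiv ℝ
        (fun _ : Fin (k + 1) => EuclideanSpace ℝ (Fin d)) ℂ)).comp_aestronglyMeasurable
        (hmeas (k + 1) ξ)
      refine h.congr (ae_of_all _ fun η => ?_)
      show _ = φ η • fderiv ℝ (iteratedFDeriv ℝ k G) (ξ - c • η)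
      rw [hfd]
      rfl
    · refine ae_of_all _ fun η x _ => ?_
      rw [norm_smul, norm_fderiv_iteratedFDeriv]
      gcongr
      exact hC' _
    · refine ae_of_all _ fun η x _ => ?_
      have h1 : HasFDerivAt (iteratedFDeriv ℝ k G) (fderiv ℝ (iteratedFDeriv ℝ k G) (x - c • η))
          (x - c • η) := (hdiff k _).hasFDerivAt
      have h2 : HasFDerivAt (fun x => x - c • η)
          (ContinuousLinearMap.id ℝ (EuclideanSpace ℝ (Fin d))) x := (hasFDerivAt_id x).sub_const _
      have h3 := (h1.comp x h2).const_smul (φ η)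
      rwa [ContinuousLinearMap.comp_id] at h3
  have hform : ∀ k : ℕ, iteratedFDeriv ℝ k (fun ξ => ∫ η, φ η * G (ξ - c • η))
      = fun ξ => ∫ η, φ η • iteratedFDeriv ℝ k G (ξ - c • η) := by
    intro k
    induction k with
    | zero =>
      ext1 ξ
      simp only [iteratedFDeriv_zero_eq_comp, Function.comp_apply]
      exact (ContinuousLinearEquiv.integral_comp_comm (𝕜 := ℝ)
        (continuousMultilinearCurryFin0 ℝ (EuclideanSpace ℝ (Fin d))
          ℂ).symm.toContinuousLinearEquiv (fun η => φ η * G (ξ - c • η))).symm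
    | succ k ih =>
      rw [iteratedFDeriv_succ_eq_comp_left, ih]
      ext1 ξ
      simp only [Function.comp_apply, (hder k ξ).fderiv]
      exact (ContinuousLinearEquiv.integral_comp_comm (𝕜 := ℝ)
        (continuousMultilinearCurryLeftEquiv ℝ (fun _ : Fin (k + 1) => EuclideanSpace ℝ (Fin d))
          ℂ).symm.toContinuousLinearEquiv
        (fun η => φ η • fderiv ℝ (iteratedFDeriv ℝ k G) (ξ - c • η))).symm
  refine ⟨contDiff_of_differentiable_iteratedFDeriv fun k _ => ?_, fun k ξ => by rw [hform]⟩
  rw [hform]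
  exact fun ξ => (hder k ξ).differentiableAt

theorem fourier_eq (f : EuclideanSpace ℝ (Fin d) → ℂ) (η : EuclideanSpace ℝ (Fin d)) :
    𝓕 f η = fourier f ((2 * Real.pi) • η) := by
  rw [Real.fourier_eq', fourier]
  congr 1; ext t
  rw [smul_eq_mul, inner_smul_right]
  congr 2
  push_cast; ring

theorem fourier_mul {f g : EuclideanSpace ℝ (Fin d) → ℂ} (hf : Integrable f) (hg : Integrable g)
    (hgc : Continuous g) (hg' : Integrable (𝓕 g)) (ξ : EuclideanSpace ℝ (Fin d)) :
    fourier (fun x => f x * g x) ξ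
      = ∫ η, 𝓕 f η * fourier g (ξ - (2 * Real.pi) • η) := by
  set ζ := (2 * Real.pi)⁻¹ • ξ
  have hpi : 2 * Real.pi ≠ 0 := by positivity
  have hζ : ∀ η, fourier g (ξ - (2 * Real.pi) • η) = 𝓕 g (ζ - η) := by
    intro η
    rw [fourier_eq, smul_sub, smul_inv_smul₀ hpi]
  have hξ : fourier (fun x => f x * g x) ξ = 𝓕 (fun x => f x * g x) ζ := by
    rw [fourier_eq, smul_inv_smul₀ hpi]
  simp_rw [hζ, hξ]
  have hh : Integrable fun η => 𝓕 g (ζ - η) := hg'.comp_sub_left ζ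
  have key : ∀ t, 𝓕 (fun η => 𝓕 g (ζ - η)) t
      = Complex.exp (↑(-2 * Real.pi * inner ℝ t ζ) * Complex.I) * g t := by
    intro t
    have hinv : 𝓕⁻ (𝓕 g) t = g t := congrFun (hgc.fourierInv_fourier_eq hg hg') t
    rw [← hinv, Real.fourier_eq', Real.fourierInv_eq']
    rw [← integral_sub_left_eq_self _ volume ζ, ← integral_const_mul]
    congr 1; ext η
    simp only [smul_eq_mul, sub_sub_cancel]
    rw [← mul_assoc, ← Complex.exp_add]
    congr 2
    rw [inner_sub_left, real_inner_comm ζ t]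
    push_cast; ring
  have hflip : ∫ η, 𝓕 f η * 𝓕 g (ζ - η) = ∫ t, f t * 𝓕 (fun η => 𝓕 g (ζ - η)) t := by
    have := VectorFourier.integral_fourierIntegral_smul_eq_flip (μ := volume) (ν := volume)
      (e := Real.fourierChar)
      (L := innerₗ (EuclideanSpace ℝ (Fin d))) Real.continuous_fourierChar
      (by exact continuous_inner) hf hh
    simp only [flip_innerₗ, smul_eq_mul] at this
    exact this
  rw [hflip, Real.fourier_eq']
  congr 1; ext t
  rw [key, smul_eq_mul]; ring

theorem mul_mem_sOmega {f g : EuclideanSpace ℝ (Fin d) → ℂ} (hf : f ∈ sOmega ω d)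
    (hg : g ∈ sOmega ω d) : (fun x => f x * g x) ∈ sOmega ω d := by
  obtain ⟨hf1, hf2, hf3⟩ := hf
  obtain ⟨hg1, hg2, hg3⟩ := hg
  have hpi : 2 * Real.pi ≠ 0 := by positivity
  obtain ⟨L, hL, hadd⟩ := ω.add_le
  have hcont : ∀ {u : EuclideanSpace ℝ (Fin d) → ℂ}, Decays ω (fourier u) → Continuous (𝓕 u) := by
    intro u hu
    have : 𝓕 u = fun η => fourier u ((2 * Real.pi) • η) := funext (fourier_eq u)
    rw [this]
    exact hu.1.continuous.comp (by fun_prop)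
  have hF : ∀ {u : EuclideanSpace ℝ (Fin d) → ℂ}, Decays ω (fourier u) → ∀ M : ℝ,
      Integrable fun η => ‖𝓕 u η‖ * Real.exp (M * ω ‖(2 * Real.pi) • η‖) := by
    intro u hu M
    have h := integrable_weighted (ω := ω) hu.1.continuous (fun l hl => by
      obtain ⟨C, -, h⟩ := hu.exists_bound hl 0
      exact ⟨C, fun x => by simpa using h x⟩) M
    simp only [fourier_eq]
    exact h.comp_smul hpi
  have hI : ∀ {u : EuclideanSpace ℝ (Fin d) → ℂ}, Decays ω (fourier u) → Integrable (𝓕 u) := by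
    intro u hu
    have := hF hu 0
    simp only [zero_mul, Real.exp_zero, mul_one] at this
    exact (integrable_norm_iff (hcont hu).aestronglyMeasurable).1 this
  have hfor : fourier (fun x => f x * g x)
      = fun ξ => ∫ η, 𝓕 f η * fourier g (ξ - (2 * Real.pi) • η) :=
    funext (fourier_mul hf1 hg1 hg2.1.continuous (hI hg3))
  obtain ⟨hsm, hD⟩ := iteratedFDeriv_conv (2 * Real.pi) (hI hf3) hg3.1 fun k => by
    obtain ⟨C, -, h⟩ := hg3.exists_bound' k
    exact ⟨C, h⟩
  obtain ⟨Cf, -, hCf⟩ := hf2.exists_bound' 0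
  refine ⟨hg1.bdd_mul (c := Cf) hf2.1.continuous.aestronglyMeasurable
    (ae_of_all _ fun x => by simpa using hCf x), hf2.mul hg2, ?_⟩
  rw [hfor]
  refine ⟨hsm, fun l hl k => ?_⟩
  have hlL : 0 < l * L := by positivity
  obtain ⟨C, hC0, hC⟩ := hg3.exists_bound hlL k
  refine ⟨∫ η, ‖𝓕 f η‖ * Real.exp ((l * L) * ω ‖(2 * Real.pi) • η‖) *
    (C * Real.exp (l * L)), ?_⟩
  rintro _ ⟨ξ, rfl⟩
  unfold weighted
  rw [hD k ξ, ← le_div_iff₀ (Real.exp_pos _), div_eq_mul_inv, ← Real.exp_neg,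
    ← integral_mul_const]
  refine norm_integral_le_of_norm_le (((hF hf3 (l * L)).mul_const _).mul_const _)
    (ae_of_all _ fun η => ?_)
  rw [norm_smul]
  set y := (2 * Real.pi) • η
  have hξ : ω ‖ξ‖ ≤ L * (ω ‖y‖ + ω ‖ξ - y‖) + L := by
    refine (ω.monotoneOn (norm_nonneg ξ) (add_nonneg (norm_nonneg y) (norm_nonneg (ξ - y))) ?_).trans
      (hadd _ _ (norm_nonneg _) (norm_nonneg _))
    simpa using norm_add_le y (ξ - y)
  calc ‖𝓕 f η‖ * ‖iteratedFDeriv ℝ k (fourier g) (ξ - y)‖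
      ≤ ‖𝓕 f η‖ * (C * Real.exp (-(l * L * ω ‖ξ - y‖))) := by gcongr; exact hC _
    _ ≤ ‖𝓕 f η‖ * (C * Real.exp (l * L * ω ‖y‖ + l * L + -(l * ω ‖ξ‖))) := by
        gcongr
        linear_combination l * hξ
    _ = _ := by rw [Real.exp_add, Real.exp_add]; ring

/-- The pointwise product of two elements of `𝓢_ω(ℝ^d)`. -/
def SOmega.mul (f g : SOmega ω d) : SOmega ω d :=
  ⟨fun x => f x * g x, mul_mem_sOmega f.mem g.mem⟩

theorem SOmega.mul_apply (f g : SOmega ω d) (x : EuclideanSpace ℝ (Fin d)) :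
    SOmega.mul f g x = f x * g x := rfl

end product

end BMT

end

/-!
A compact operator sends some neighbourhood of zero to a bounded set. Hence finitely many defining
seminorms control all the seminorms of its values (`exists_seminormFamily_le_of_isCompactOperator`).
Multiplication by `a` commutes with the modulations `f ↦ e^{i x·t} f`, and modulation acts on the
Fourier side as translation by `t`. By the quasi-subadditivity of `ω` each seminorm of the modulated
function `e^{i x·t} f` is at most `C e^{N ω(t)}`, and one `N` serves for the finitely many
controlling seminorms. The seminorm `sup |ĝ| e^{μ ω}` of `e^{i x·t} g`, on the other hand, is at
least a multiple of `e^{(μ / L) ω(t)}` if `ĝ ≠ 0`. Taking `g = a f` and `μ` large, and using that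
`ω` is unbounded, shows that `a f = 0` for all `f`
(`SOmega.eq_zero_of_isCompactOperator_of_modulate`).

To conclude that `a = 0`, Gaussians are used; they lie in `𝓢_ω(ℝ^d)` because condition `(β)` forces
`ω` to grow at most linearly. A Gaussian vanishes nowhere, which settles the case of a function `a`.
For `a ∈ 𝓢_ω'(ℝ^d)` one gets `⟨a, f h⟩ = 0` for all `f` and `h`, and `f` is the limit of the
products `f · e^{-ε² |x|²}` as `ε → 0` (`SOmega.tendsto_mul_gaussian`).

The Schwartz space is `𝓢_ω(ℝ^d)` for the weight `ω(t) = log (1 + t)`, including the topology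
(`SOmega.equivSchwartz`), so the statements about it are special cases.
-/

noncomputable section

/-! ### Growth of weight functions -/

namespace WeightFunction

/-- Non-quasianalytic weights grow at most linearly: by monotonicity, the integral over `[T, 2T]` of
the integrable function `ω(t) / (1 + t²)` is at least `ω(T) / (5T)`. -/
theorem exists_le_mul_one_add (ω : WeightFunction) :
    ∃ B : ℝ, 0 ≤ B ∧ ∀ t, 0 ≤ t → ω t ≤ B * (1 + t) := by
  set I : ℝ := ∫ t in Ioi (1 : ℝ), ω t / (1 + t ^ 2)
  have hnn : ∀ t ∈ Ioi (1 : ℝ), 0 ≤ ω t / (1 + t ^ 2) := fun t ht =>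
    div_nonneg (ω.nonneg t (zero_le_one.trans (le_of_lt ht))) (by positivity)
  have hI : 0 ≤ I := setIntegral_nonneg measurableSet_Ioi hnn
  have key : ∀ T : ℝ, 1 ≤ T → ω T ≤ 5 * I * T := by
    intro T hT
    have hT0 : 0 ≤ T := zero_le_one.trans hT
    have hsub : Ioc T (2 * T) ⊆ Ioi 1 := fun x hx => lt_of_le_of_lt hT hx.1
    have h1 : ∫ t in Ioc T (2 * T), ω t / (1 + t ^ 2) ≤ I :=
      setIntegral_mono_set ω.integrableOn
        ((ae_restrict_iff' measurableSet_Ioi).2 (ae_of_all _ hnn)) hsub.eventuallyLE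
    have h2 : ∫ t in Ioc T (2 * T), ω T / (5 * T ^ 2) ≤
        ∫ t in Ioc T (2 * T), ω t / (1 + t ^ 2) := by
      refine setIntegral_mono_on (by simp) (ω.integrableOn.mono_set hsub)
        measurableSet_Ioc fun t ht => ?_
      have hmon := ω.monotoneOn hT0 (hT0.trans ht.1.le) ht.1.le
      have : 1 + t ^ 2 ≤ 5 * T ^ 2 := by nlinarith [ht.1, ht.2]
      exact div_le_div₀ (ω.nonneg t (hT0.trans ht.1.le)) hmon (by positivity) this
    have h3 : ∫ t in Ioc T (2 * T), ω T / (5 * T ^ 2) = ω T / (5 * T) := by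
      rw [setIntegral_const, Real.volume_real_Ioc_of_le (by linarith), smul_eq_mul]
      field_simp
      ring
    have h4 : ω T / (5 * T) ≤ I := h3 ▸ h2.trans h1
    rw [div_le_iff₀ (by positivity)] at h4
    linarith
  refine ⟨5 * I, by positivity, fun t ht => ?_⟩
  calc ω t ≤ ω (1 + t) := ω.monotoneOn ht (by simp; linarith) (by linarith)
    _ ≤ _ := key _ (by linarith)

theorem norm_add_le (ω : WeightFunction) {E : Type*} [SeminormedAddCommGroup E] {L : ℝ}
    (h : ∀ s t, 0 ≤ s → 0 ≤ t → ω (s + t) ≤ L * (ω s + ω t) + L) (x y : E) :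
    ω ‖x + y‖ ≤ L * (ω ‖x‖ + ω ‖y‖) + L :=
  (ω.monotoneOn (norm_nonneg _) (add_nonneg (norm_nonneg x) (norm_nonneg y))
    (_root_.norm_add_le x y)).trans (h _ _ (norm_nonneg _) (norm_nonneg _))

/-- A power of `1 + t` is dominated by an exponential of `ω`. -/
theorem exists_pow_le (ω : WeightFunction) (k : ℕ) :
    ∃ C N : ℝ, 0 ≤ C ∧ 0 ≤ N ∧ ∀ t, 0 ≤ t → (1 + t) ^ k ≤ C * Real.exp (N * ω t) := by
  obtain ⟨A, K, hK, h⟩ := ω.log_le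
  refine ⟨Real.exp (k * A), k * K, (Real.exp_pos _).le, by positivity, fun t ht => ?_⟩
  rw [← Real.exp_add, ← Real.exp_log (show 0 < 1 + t by linarith), ← Real.exp_nat_mul]
  refine Real.exp_le_exp.2 ?_
  have := mul_le_mul_of_nonneg_left (h t ht) (Nat.cast_nonneg (α := ℝ) k)
  linarith

/-- A weight function is unbounded, since it dominates the logarithm. -/
theorem exists_lt (ω : WeightFunction) (R : ℝ) : ∃ t, 0 ≤ t ∧ R < ω t := by
  obtain ⟨A, K, hK, h⟩ := ω.log_le
  have hpos : (0 : ℝ) ≤ |A + K * R| + 1 := by positivity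
  refine ⟨Real.exp (|A + K * R| + 1) - 1, by linarith [Real.add_one_le_exp (|A + K * R| + 1)], ?_⟩
  have h1 := h (Real.exp (|A + K * R| + 1) - 1)
    (by linarith [Real.add_one_le_exp (|A + K * R| + 1)])
  rw [add_sub_cancel, Real.log_exp] at h1
  have h2 : K * R < K * ω (Real.exp (|A + K * R| + 1) - 1) := by
    linarith [le_abs_self (A + K * R)]
  exact lt_of_mul_lt_mul_left h2 hK.le

/-- A Gaussian beats every power of `1 + t` and, since `ω` grows at most linearly, every exponential
of `ω`. -/
theorem exists_gaussian_le (ω : WeightFunction) {b : ℝ} (hb : 0 < b) {l : ℝ} (hl : 0 ≤ l)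
    (m : ℕ) :
    ∃ C : ℝ, 0 ≤ C ∧ ∀ t, 0 ≤ t → (1 + t) ^ m * Real.exp (-(b * t ^ 2)) * Real.exp (l * ω t) ≤ C
    := by
  obtain ⟨B, hB, h⟩ := ω.exists_le_mul_one_add
  refine ⟨Real.exp (l * B + (m + l * B) ^ 2 / (4 * b)), (Real.exp_pos _).le, fun t ht => ?_⟩
  have h1 : (1 + t) ^ m ≤ Real.exp (m * t) := by
    rw [Real.exp_nat_mul]
    gcongr
    linarith [Real.add_one_le_exp t]
  refine (mul_le_mul_of_nonneg_right (mul_le_mul_of_nonneg_right h1 (Real.exp_pos _).le)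
    (Real.exp_pos _).le).trans ?_
  rw [← Real.exp_add, ← Real.exp_add, Real.exp_le_exp]
  have h2 := mul_le_mul_of_nonneg_left (h t ht) hl
  have h3 : (m + l * B) * t - b * t ^ 2 ≤ (m + l * B) ^ 2 / (4 * b) := by
    rw [le_div_iff₀ (by positivity)]
    nlinarith [sq_nonneg (2 * b * t - (m + l * B))]
  linarith

end WeightFunction

namespace BMT

variable {d : ℕ} {ω : WeightFunction}

theorem Decays.const_mul {u : EuclideanSpace ℝ (Fin d) → ℂ} (c : ℂ) (hu : Decays ω u) :
    Decays ω (fun x => c * u x) := hu.smul c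

theorem Decays.integrable_weighted {u : EuclideanSpace ℝ (Fin d) → ℂ} (hu : Decays ω u) (M : ℝ) :
    Integrable fun x => ‖u x‖ * Real.exp (M * ω ‖x‖) :=
  BMT.integrable_weighted hu.1.continuous (fun l hl => by
    obtain ⟨C, -, h⟩ := hu.exists_bound hl 0
    exact ⟨C, fun x => by simpa using h x⟩) M

theorem Decays.integrable {u : EuclideanSpace ℝ (Fin d) → ℂ} (hu : Decays ω u) :
    Integrable u := by
  have := hu.integrable_weighted 0
  simp only [zero_mul, Real.exp_zero, mul_one] at this
  exact (integrable_norm_iff hu.1.continuous.aestronglyMeasurable).1 this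

theorem contDiff_cexp_const_mul (c : ℂ) :
    ContDiff ℝ (⊤ : ℕ∞) (fun s : ℝ => Complex.exp (c * s)) :=
  Complex.contDiff_exp.comp (contDiff_const.mul Complex.ofRealCLM.contDiff)

theorem norm_iteratedFDeriv_cexp_const_mul (c : ℂ) (n : ℕ) (s : ℝ) :
    ‖iteratedFDeriv ℝ n (fun s : ℝ => Complex.exp (c * s)) s‖
      = ‖c‖ ^ n * ‖Complex.exp (c * s)‖ := by
  have h : iteratedDeriv n (fun s : ℝ => Complex.exp (c * s))
      = fun s : ℝ => c ^ n * Complex.exp (c * s) := by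
    induction n with
    | zero => simp
    | succ n ih =>
      rw [iteratedDeriv_succ, ih]
      ext s
      have h1 : HasDerivAt (fun s : ℝ => c * (s : ℂ)) c s := by
        simpa using (Complex.ofRealCLM.hasDerivAt (x := s)).const_mul c
      rw [(h1.cexp.const_mul (c ^ n)).deriv]
      ring
  rw [norm_iteratedFDeriv_eq_norm_iteratedDeriv, h, norm_mul, norm_pow]

/-! ### Gaussians -/

/-- The Gaussian `x ↦ e^{-b |x|²}`. -/
def gaussian {d : ℕ} (b : ℝ) (x : EuclideanSpace ℝ (Fin d)) : ℂ :=
  Complex.exp (-(b : ℂ) * ((‖x‖ ^ 2 : ℝ) : ℂ))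

theorem norm_gaussian (b : ℝ) (x : EuclideanSpace ℝ (Fin d)) :
    ‖gaussian b x‖ = Real.exp (-(b * ‖x‖ ^ 2)) := by
  rw [gaussian, Complex.norm_exp]
  congr 1
  rw [← Complex.ofReal_neg, ← Complex.ofReal_mul, Complex.ofReal_re, neg_mul]

theorem gaussian_ne_zero (b : ℝ) (x : EuclideanSpace ℝ (Fin d)) : gaussian b x ≠ 0 :=
  Complex.exp_ne_zero _

theorem contDiff_gaussian (b : ℝ) :
    ContDiff ℝ (⊤ : ℕ∞) (gaussian b : EuclideanSpace ℝ (Fin d) → ℂ) :=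
  (contDiff_cexp_const_mul (-(b : ℂ))).comp (contDiff_norm_sq ℝ)

/-- The bound comes from the chain rule for `s ↦ e^{-b s}` and `x ↦ |x|²`, the latter having
derivatives of polynomial growth. -/
theorem norm_iteratedFDeriv_gaussian_le {b : ℝ} (hb : 0 ≤ b) (n : ℕ) :
    ∃ C : ℝ, ∃ m : ℕ, 0 ≤ C ∧ ∀ x : EuclideanSpace ℝ (Fin d),
      ‖iteratedFDeriv ℝ n (gaussian b) x‖ ≤ C * ((1 + ‖x‖) ^ m * Real.exp (-(b * ‖x‖ ^ 2))) := by
  obtain ⟨k, C, hC, h⟩ :=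
    (Function.hasTemperateGrowth_norm_sq (EuclideanSpace ℝ (Fin d))).norm_iteratedFDeriv_le_uniform
      n
  refine ⟨n.factorial * (1 + b) ^ n * (1 + C) ^ n, k * n, by positivity, fun x => ?_⟩
  refine (norm_iteratedFDeriv_comp_le (contDiff_cexp_const_mul (-(b : ℂ))) (contDiff_norm_sq ℝ)
    (n := n) (by exact_mod_cast le_top) x (C := (1 + b) ^ n * Real.exp (-(b * ‖x‖ ^ 2)))
    (D := (1 + C) * (1 + ‖x‖) ^ k) (fun i hi => ?_) fun i hi hin => ?_).trans (le_of_eq ?_)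
  · rw [norm_iteratedFDeriv_cexp_const_mul]
    have := norm_gaussian b x
    rw [gaussian] at this
    rw [this, norm_neg, Complex.norm_real, Real.norm_of_nonneg hb]
    gcongr
    calc b ^ i ≤ (1 + b) ^ i := by gcongr; linarith
      _ ≤ (1 + b) ^ n := pow_le_pow_right₀ (by linarith) hi
  · have h1 : 1 ≤ (1 + C) * (1 + ‖x‖) ^ k :=
      one_le_mul_of_one_le_of_one_le (by linarith) (one_le_pow₀ (by linarith [norm_nonneg x]))
    calc _ ≤ C * (1 + ‖x‖) ^ k := h i hin x
      _ ≤ (1 + C) * (1 + ‖x‖) ^ k := by gcongr; linarith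
      _ ≤ _ := le_self_pow₀ h1 (by omega)
  · rw [mul_pow, ← pow_mul]
    ring

theorem decays_gaussian (ω : WeightFunction) {b : ℝ} (hb : 0 < b) :
    Decays ω (gaussian b : EuclideanSpace ℝ (Fin d) → ℂ) := by
  refine ⟨contDiff_gaussian b, fun l hl k => ?_⟩
  obtain ⟨C, m, hC, h⟩ := norm_iteratedFDeriv_gaussian_le (d := d) hb.le k
  obtain ⟨C', hC', h'⟩ := ω.exists_gaussian_le hb hl.le m
  refine ⟨C * C', ?_⟩
  rintro _ ⟨x, rfl⟩
  calc _ ≤ C * ((1 + ‖x‖) ^ m * Real.exp (-(b * ‖x‖ ^ 2))) * Real.exp (l * ω ‖x‖) := by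
        unfold weighted; gcongr; exact h x
    _ = C * ((1 + ‖x‖) ^ m * Real.exp (-(b * ‖x‖ ^ 2)) * Real.exp (l * ω ‖x‖)) := by ring
    _ ≤ _ := mul_le_mul_of_nonneg_left (h' _ (norm_nonneg x)) hC

theorem fourier_gaussian {b : ℝ} (hb : 0 < b) :
    ∃ c : ℂ, fourier (gaussian b : EuclideanSpace ℝ (Fin d) → ℂ)
      = fun ξ => c * gaussian (1 / (4 * b)) ξ := by
  have hpi : 2 * Real.pi ≠ 0 := by positivity
  refine ⟨(Real.pi / (b : ℂ)) ^ (Module.finrank ℝ (EuclideanSpace ℝ (Fin d)) / 2 : ℂ),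
    funext fun ξ => ?_⟩
  have h1 : (gaussian b : EuclideanSpace ℝ (Fin d) → ℂ)
      = fun v => Complex.exp (-(b : ℂ) * (‖v‖ : ℂ) ^ 2) := by
    ext v; simp [gaussian]
  have h2 : fourier (gaussian b) ξ = 𝓕 (gaussian b) ((2 * Real.pi)⁻¹ • ξ) := by
    rw [fourier_eq, smul_inv_smul₀ hpi]
  rw [h2, h1, fourier_gaussian_innerProductSpace (by simpa using hb)]
  congr 1
  rw [gaussian, norm_smul]
  congr 1
  have hb' : (b : ℂ) ≠ 0 := by exact_mod_cast hb.ne'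
  have hpi' : (Real.pi : ℂ) ≠ 0 := by exact_mod_cast Real.pi_ne_zero
  rw [Real.norm_of_nonneg (by positivity)]
  push_cast
  field_simp
  ring

theorem gaussian_mem_sOmega (ω : WeightFunction) {b : ℝ} (hb : 0 < b) :
    (gaussian b : EuclideanSpace ℝ (Fin d) → ℂ) ∈ sOmega ω d := by
  obtain ⟨c, hc⟩ := fourier_gaussian (d := d) hb
  refine ⟨(decays_gaussian ω hb).integrable, decays_gaussian ω hb, ?_⟩
  rw [hc]
  exact (decays_gaussian ω (by positivity)).const_mul c

/-- The Gaussian `x ↦ e^{-b |x|²}` as an element of `𝓢_ω(ℝ^d)`. -/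
def SOmega.gaussian (ω : WeightFunction) (d : ℕ) {b : ℝ} (hb : 0 < b) : SOmega ω d :=
  ⟨BMT.gaussian b, gaussian_mem_sOmega ω hb⟩

theorem SOmega.gaussian_apply {b : ℝ} (hb : 0 < b) (x : EuclideanSpace ℝ (Fin d)) :
    SOmega.gaussian ω d hb x = BMT.gaussian b x := rfl

/-! ### Modulations -/

/-- The character `x ↦ e^{i x·t}`. -/
def character {d : ℕ} (t x : EuclideanSpace ℝ (Fin d)) : ℂ :=
  Complex.exp (Complex.I * (inner ℝ t x : ℝ))

theorem contDiff_character (t : EuclideanSpace ℝ (Fin d)) :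
    ContDiff ℝ (⊤ : ℕ∞) (character t) :=
  (contDiff_cexp_const_mul Complex.I).comp (innerSL ℝ t).contDiff

theorem norm_iteratedFDeriv_character_le (n : ℕ) (t x : EuclideanSpace ℝ (Fin d)) :
    ‖iteratedFDeriv ℝ n (character t) x‖ ≤ ‖t‖ ^ n := by
  have h := (innerSL ℝ t).iteratedFDeriv_comp_right (contDiff_cexp_const_mul Complex.I) x
    (i := n) (by exact_mod_cast le_top)
  have h' : character t = (fun s : ℝ => Complex.exp (Complex.I * s)) ∘ (innerSL ℝ t) := rfl
  rw [h', h]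
  refine (ContinuousMultilinearMap.norm_compContinuousLinearMap_le _ _).trans (le_of_eq ?_)
  rw [norm_iteratedFDeriv_cexp_const_mul, Finset.prod_const, Finset.card_univ, Fintype.card_fin,
    innerSL_apply_norm]
  simp [Complex.norm_exp]

theorem fourier_character_mul (u : EuclideanSpace ℝ (Fin d) → ℂ)
    (t : EuclideanSpace ℝ (Fin d)) :
    fourier (fun x => character t x * u x) = fun ξ => fourier u (ξ - t) := by
  ext ξ
  unfold fourier character
  congr 1; ext x
  rw [← mul_assoc, ← Complex.exp_add, inner_sub_right, real_inner_comm t x]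
  congr 2
  push_cast; ring

/-- Multiplication by the character of frequency `t` costs only a factor `e^{N ω(t)}`. -/
theorem Decays.exists_weighted_character_mul_le {u : EuclideanSpace ℝ (Fin d) → ℂ}
    (hu : Decays ω u) {l : ℝ} (hl : 0 < l) (k : ℕ) :
    ∃ C N : ℝ, 0 ≤ C ∧ 0 ≤ N ∧ ∀ t x,
      weighted ω l k (fun x => character t x * u x) x ≤ C * Real.exp (N * ω ‖t‖) := by
  choose A hA0 hA using fun i => hu.exists_bound hl i
  obtain ⟨C, N, hC, hN, h⟩ := ω.exists_pow_le k
  have hS : 0 ≤ ∑ i ∈ Finset.range (k + 1), (k.choose i : ℝ) * A (k - i) :=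
    Finset.sum_nonneg fun i _ => mul_nonneg (Nat.cast_nonneg _) (hA0 _)
  refine ⟨(∑ i ∈ Finset.range (k + 1), (k.choose i : ℝ) * A (k - i)) * C, N,
    mul_nonneg hS hC, hN, fun t x => ?_⟩
  have h1 := norm_iteratedFDeriv_mul_le (n := k) (N := ((⊤ : ℕ∞) : WithTop ℕ∞))
    (contDiff_character t) hu.1 x (by exact_mod_cast le_top)
  unfold weighted
  rw [← le_div_iff₀ (Real.exp_pos _), div_eq_mul_inv, ← Real.exp_neg]
  refine h1.trans ?_
  rw [mul_assoc _ C, mul_assoc, Finset.sum_mul]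
  refine Finset.sum_le_sum fun i hi => ?_
  have hi' : i ≤ k := Nat.lt_succ_iff.1 (Finset.mem_range.1 hi)
  have h2 : ‖iteratedFDeriv ℝ i (character t) x‖ ≤ C * Real.exp (N * ω ‖t‖) := by
    refine (norm_iteratedFDeriv_character_le i t x).trans ?_
    refine le_trans ?_ (h _ (norm_nonneg t))
    calc ‖t‖ ^ i ≤ (1 + ‖t‖) ^ i := by gcongr; linarith
      _ ≤ (1 + ‖t‖) ^ k := pow_le_pow_right₀ (by linarith [norm_nonneg t]) hi'
  calc _ ≤ (k.choose i : ℝ) * (C * Real.exp (N * ω ‖t‖)) *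
        (A (k - i) * Real.exp (-(l * ω ‖x‖))) := by
        gcongr
        exact hA _ x
    _ = _ := by ring

/-- Translation by `t` costs only a factor `e^{N ω(t)}`. -/
theorem Decays.exists_weighted_translate_le {u : EuclideanSpace ℝ (Fin d) → ℂ}
    (hu : Decays ω u) {l : ℝ} (hl : 0 < l) (k : ℕ) :
    ∃ C N : ℝ, 0 ≤ C ∧ 0 ≤ N ∧ ∀ t x,
      weighted ω l k (fun x => u (x - t)) x ≤ C * Real.exp (N * ω ‖t‖) := by
  obtain ⟨L, hL, hadd⟩ := ω.add_le
  have hlL : 0 < l * L := by positivity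
  obtain ⟨C, hC0, hC⟩ := hu.exists_bound hlL k
  refine ⟨C * Real.exp (l * L), l * L, by positivity, hlL.le, fun t x => ?_⟩
  have h1 := ω.norm_add_le hadd (x - t) t
  rw [sub_add_cancel] at h1
  have h2 := mul_le_mul_of_nonneg_left h1 hl.le
  unfold weighted
  rw [iteratedFDeriv_comp_sub]
  calc _ ≤ C * Real.exp (-(l * L * ω ‖x - t‖)) * Real.exp (l * ω ‖x‖) := by gcongr; exact hC _
    _ = C * Real.exp (-(l * L * ω ‖x - t‖) + l * ω ‖x‖) := by rw [mul_assoc, ← Real.exp_add]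
    _ ≤ C * Real.exp (l * L + l * L * ω ‖t‖) := by
        refine mul_le_mul_of_nonneg_left (Real.exp_le_exp.2 ?_) hC0
        linarith
    _ = _ := by rw [Real.exp_add, ← mul_assoc]

theorem character_mul_mem_sOmega {u : EuclideanSpace ℝ (Fin d) → ℂ} (hu : u ∈ sOmega ω d)
    (t : EuclideanSpace ℝ (Fin d)) : (fun x => character t x * u x) ∈ sOmega ω d := by
  obtain ⟨-, h2, h3⟩ := hu
  have h : Decays ω (fun x => character t x * u x) := by
    refine ⟨(contDiff_character t).mul h2.1, fun l hl k => ?_⟩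
    obtain ⟨C, N, -, -, h⟩ := h2.exists_weighted_character_mul_le hl k
    exact ⟨_, forall_mem_range.2 (h t)⟩
  refine ⟨h.integrable, h, ?_⟩
  rw [fourier_character_mul]
  refine ⟨h3.1.comp (contDiff_id.sub contDiff_const), fun l hl k => ?_⟩
  obtain ⟨C, N, -, -, h⟩ := h3.exists_weighted_translate_le hl k
  exact ⟨_, forall_mem_range.2 (h t)⟩

namespace SOmega

/-- The modulation `x ↦ e^{i x·t} f(x)` of `f ∈ 𝓢_ω(ℝ^d)`. -/
def modulate (t : EuclideanSpace ℝ (Fin d)) (f : SOmega ω d) : SOmega ω d :=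
  ⟨fun x => character t x * f x, character_mul_mem_sOmega f.mem t⟩

theorem modulate_apply (t : EuclideanSpace ℝ (Fin d)) (f : SOmega ω d)
    (x : EuclideanSpace ℝ (Fin d)) : modulate t f x = character t x * f x := rfl

theorem fourier_modulate (t : EuclideanSpace ℝ (Fin d)) (f : SOmega ω d) :
    fourier (modulate t f) = fun ξ => fourier f (ξ - t) := fourier_character_mul f t

theorem exists_seminormFamily_modulate_le (f : SOmega ω d)
    (i : ({l : ℝ // 0 < l} × ℕ) ⊕ ({l : ℝ // 0 < l} × ℕ)) :
    ∃ C N : ℝ, 0 ≤ C ∧ 0 ≤ N ∧ ∀ t,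
      seminormFamily ω d i (modulate t f) ≤ C * Real.exp (N * ω ‖t‖) := by
  rcases i with ⟨l, k⟩ | ⟨l, k⟩
  · obtain ⟨C, N, hC, hN, h⟩ := f.decays.exists_weighted_character_mul_le l.2 k
    exact ⟨C, N, hC, hN, fun t => ciSup_le (h t)⟩
  · obtain ⟨C, N, hC, hN, h⟩ := f.decays_fourier.exists_weighted_translate_le l.2 k
    refine ⟨C, N, hC, hN, fun t => ciSup_le fun ξ => ?_⟩
    refine le_trans (le_of_eq ?_) (h t ξ)
    rw [← fourier_modulate]
    rfl

theorem exists_finset_sup_modulate_le (f : SOmega ω d)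
    (s : Finset (({l : ℝ // 0 < l} × ℕ) ⊕ ({l : ℝ // 0 < l} × ℕ))) :
    ∃ C N : ℝ, 0 ≤ C ∧ 0 ≤ N ∧ ∀ t,
      s.sup (seminormFamily ω d) (modulate t f) ≤ C * Real.exp (N * ω ‖t‖) := by
  choose C N hC hN h using f.exists_seminormFamily_modulate_le
  refine ⟨∑ i ∈ s, C i, ∑ i ∈ s, N i, Finset.sum_nonneg fun i _ => hC i,
    Finset.sum_nonneg fun i _ => hN i, fun t => ?_⟩
  have hω := ω.nonneg _ (norm_nonneg t)
  refine Seminorm.finset_sup_apply_le (mul_nonneg (Finset.sum_nonneg fun i _ => hC i)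
    (Real.exp_pos _).le) fun i hi => (h i t).trans ?_
  gcongr
  · exact Finset.sum_nonneg fun i _ => hC i
  · exact Finset.single_le_sum (fun i _ => hC i) hi
  · exact Finset.single_le_sum (fun i _ => hN i) hi

theorem norm_fourier_mul_le_q (l : {l : ℝ // 0 < l}) (f : SOmega ω d)
    (ξ : EuclideanSpace ℝ (Fin d)) :
    ‖fourier f ξ‖ * Real.exp (l * ω ‖ξ‖) ≤ q l 0 f := by
  have h := le_ciSup (f.decays_fourier.2 l l.2 0) ξ
  rw [weighted, norm_iteratedFDeriv_zero] at h
  exact h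

/-- Conversely, modulation by `t` makes the seminorms of the Fourier transform grow: away from
`f = 0`, the seminorm with weight `e^{μ ω}` grows at least like `e^{(μ / L) ω(t)}`. -/
theorem exists_norm_fourier_mul_exp_le {N : ℝ} (hN : 0 ≤ N) (ξ : EuclideanSpace ℝ (Fin d)) :
    ∃ (l : {l : ℝ // 0 < l}) (C : ℝ), 0 ≤ C ∧ ∀ (g : SOmega ω d) (t : EuclideanSpace ℝ (Fin d)),
      ‖fourier g ξ‖ * Real.exp ((N + 1) * ω ‖t‖) ≤ C * q l 0 (modulate t g) := by
  obtain ⟨L, hL, hadd⟩ := ω.add_le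
  refine ⟨⟨(N + 1) * L, by positivity⟩, Real.exp ((N + 1) * (L * ω ‖ξ‖ + L)), (Real.exp_pos _).le,
    fun g t => ?_⟩
  have h1 := norm_fourier_mul_le_q ⟨(N + 1) * L, by positivity⟩ (modulate t g) (ξ + t)
  simp only [fourier_modulate, add_sub_cancel_right] at h1
  refine le_trans ?_ (mul_le_mul_of_nonneg_left h1 (Real.exp_pos _).le)
  rw [mul_left_comm, ← Real.exp_add]
  gcongr
  have h2 := ω.norm_add_le hadd (ξ + t) (-ξ)
  rw [add_neg_cancel_comm, norm_neg] at h2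
  linear_combination (N + 1) * h2

end SOmega

/-! ### Operators that commute with modulations -/

theorem integrable_fourierTransform {u : EuclideanSpace ℝ (Fin d) → ℂ}
    (hu : Decays ω (fourier u)) : Integrable (𝓕 u) := by
  rw [show 𝓕 u = fun η => fourier u ((2 * Real.pi) • η) from funext (fourier_eq u)]
  exact hu.integrable.comp_smul (by positivity)

namespace SOmega

theorem fourierInv_fourier_eq (f : SOmega ω d) : 𝓕⁻ (𝓕 (f : EuclideanSpace ℝ (Fin d) → ℂ)) = f :=
  f.decays.1.continuous.fourierInv_fourier_eq f.integrable
    (integrable_fourierTransform f.decays_fourier)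

theorem eq_zero_of_fourier_eq_zero {f : SOmega ω d} (h : ∀ ξ, fourier f ξ = 0) : f = 0 := by
  have h1 : 𝓕 (f : EuclideanSpace ℝ (Fin d) → ℂ) = 0 := by
    ext ξ
    rw [fourier_eq, h, Pi.zero_apply]
  refine DFunLike.coe_injective ?_
  change ⇑f = 0
  rw [← f.fourierInv_fourier_eq, h1]
  ext x
  simp [Real.fourierInv_eq']

/-- Integration against the modulated Gaussians `h` computes the Fourier transform of `f` times a
Gaussian, which is zero only for `f = 0`. -/
theorem eq_zero_of_forall_integral_mul_eq_zero {f : SOmega ω d}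
    (h : ∀ g : SOmega ω d, ∫ x, f x * g x = 0) : f = 0 := by
  have h1 : mul f (gaussian ω d one_pos) = 0 := by
    refine eq_zero_of_fourier_eq_zero fun ξ => ?_
    rw [← h (modulate (-ξ) (gaussian ω d one_pos)), fourier]
    congr 1; ext x
    rw [modulate_apply, mul_apply, character, inner_neg_left, real_inner_comm]
    push_cast
    ring_nf
  refine DFunLike.coe_injective (funext fun x => ?_)
  have h2 : f x * BMT.gaussian 1 x = 0 := by
    rw [← gaussian_apply (ω := ω) one_pos, ← mul_apply, h1]
    rfl
  exact (mul_eq_zero.1 h2).resolve_right (gaussian_ne_zero 1 x)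

/-- A compact operator maps some neighbourhood of zero to a bounded set, hence its values in every
defining seminorm are controlled by one and the same finite family of seminorms. -/
theorem exists_seminormFamily_le_of_isCompactOperator {M : SOmega ω d →ₗ[ℂ] SOmega ω d}
    (hM : IsCompactOperator M) :
    ∃ s : Finset (({l : ℝ // 0 < l} × ℕ) ⊕ ({l : ℝ // 0 < l} × ℕ)), ∀ i, ∃ C : ℝ, 0 ≤ C ∧
      ∀ f, seminormFamily ω d i (M f) ≤ C * s.sup (seminormFamily ω d) f := by
  obtain ⟨K, hK, hKM⟩ := hM
  obtain ⟨⟨s, r⟩, hr, hball⟩ := (withSeminorms (ω := ω) (d := d)).hasBasis_zero_ball.mem_iff.1 hKM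
  refine ⟨s, fun i => ?_⟩
  obtain ⟨R, hR⟩ := hK.bddAbove_image
    ((withSeminorms (ω := ω) (d := d)).continuous_seminorm i).continuousOn
  have hbound : ∀ f, s.sup (seminormFamily ω d) f < r → seminormFamily ω d i (M f) ≤ R :=
    fun f hf => hR ⟨M f, hball (by simpa [Seminorm.mem_ball] using hf), rfl⟩
  have hR0 : 0 ≤ R := (apply_nonneg _ _).trans (hbound 0 (by simpa using hr))
  refine ⟨R / r, div_nonneg hR0 (le_of_lt hr), fun f => ?_⟩
  refine le_of_forall_pos_le_add fun δ hδ => ?_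
  -- Rescale `f` by a factor slightly smaller than `r / P f`, where `P f` may vanish.
  set P := s.sup (seminormFamily ω d)
  have hP : 0 ≤ P f := apply_nonneg _ _
  set η := δ * r / (R + 1)
  have hr' : 0 < r := hr
  have hη : 0 < η := by positivity
  set c : ℝ := r / (P f + η)
  have hc : 0 < c := by positivity
  have hcn : ‖(c : ℂ)‖ = c := by rw [Complex.norm_real, Real.norm_of_nonneg hc.le]
  have h1 := hbound ((c : ℂ) • f) (by
    rw [map_smul_eq_mul, hcn, div_mul_eq_mul_div, div_lt_iff₀ (by positivity)]
    exact mul_lt_mul_of_pos_left (by linarith) hr')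
  rw [map_smul, map_smul_eq_mul, hcn, div_mul_eq_mul_div, div_le_iff₀ (by positivity)] at h1
  have h2 : R * η ≤ δ * r := by
    simp only [η]
    rw [mul_div_assoc', div_le_iff₀ (by positivity)]
    nlinarith [mul_pos hδ hr']
  rw [← sub_nonneg]
  have h3 : R / r * P f + δ - seminormFamily ω d i (M f)
      = (R * P f + δ * r - r * seminormFamily ω d i (M f)) / r := by field_simp
  rw [h3]
  exact div_nonneg (by linarith) hr'.le

/-- A compact operator commuting with all modulations is zero: along the modulations of `f` by the
frequency `t`, the finitely many seminorms that control `M` grow at most like `e^{N ω(t)}` with a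
fixed `N`, whereas if `M f ≠ 0` some seminorm of the modulations of `M f` grows at least like
`e^{(N + 1) ω(t)}`. -/
theorem eq_zero_of_isCompactOperator_of_modulate (hd : 0 < d) {M : SOmega ω d →ₗ[ℂ] SOmega ω d}
    (hM : IsCompactOperator M) (hmod : ∀ t f, M (modulate t f) = modulate t (M f)) : M = 0 := by
  ext1 f
  refine eq_zero_of_fourier_eq_zero fun ξ => ?_
  obtain ⟨s, hs⟩ := exists_seminormFamily_le_of_isCompactOperator hM
  obtain ⟨C₁, N, hC₁, hN, h₁⟩ := f.exists_finset_sup_modulate_le s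
  obtain ⟨l, C₂, hC₂, h₂⟩ := exists_norm_fourier_mul_exp_le (ω := ω) hN ξ
  obtain ⟨C₃, hC₃, h₃⟩ := hs (Sum.inr (l, 0))
  by_contra hne
  have hpos : 0 < ‖fourier (M f) ξ‖ := norm_pos_iff.2 hne
  have key : ∀ t : EuclideanSpace ℝ (Fin d),
      ‖fourier (M f) ξ‖ * ω ‖t‖ ≤ C₂ * (C₃ * C₁) := by
    intro t
    have h : ‖fourier (M f) ξ‖ * Real.exp ((N + 1) * ω ‖t‖)
        ≤ C₂ * (C₃ * C₁) * Real.exp (N * ω ‖t‖) := by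
      calc _ ≤ C₂ * q l 0 (modulate t (M f)) := h₂ (M f) t
        _ ≤ C₂ * (C₃ * (C₁ * Real.exp (N * ω ‖t‖))) := by
          refine mul_le_mul_of_nonneg_left ?_ hC₂
          rw [← hmod]
          exact (h₃ _).trans (mul_le_mul_of_nonneg_left (h₁ t) hC₃)
        _ = _ := by ring
    -- Cancel `e^{N ω(t)}` and bound the remaining factor by `e^{ω(t)} ≥ ω(t)`.
    rw [add_mul, Real.exp_add, mul_left_comm, mul_comm (Real.exp _), one_mul] at h
    refine le_trans ?_ (le_of_mul_le_mul_right h (Real.exp_pos _))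
    gcongr
    linarith [Real.add_one_le_exp (ω ‖t‖)]
  obtain ⟨T, hT, hωT⟩ := ω.exists_lt (C₂ * (C₃ * C₁) / ‖fourier (M f) ξ‖)
  have h := key (EuclideanSpace.single ⟨0, hd⟩ T)
  rw [PiLp.norm_single, Real.norm_of_nonneg hT] at h
  rw [div_lt_iff₀ hpos] at hωT
  linarith

end SOmega

/-! ### Gaussian regularization -/

/-- Mean value estimate for the derivatives of a function in the presence of the weight. -/
theorem Decays.exists_norm_iteratedFDeriv_sub_le {v : EuclideanSpace ℝ (Fin d) → ℂ}
    (hv : Decays ω v) {l : ℝ} (hl : 0 < l) (k : ℕ) :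
    ∃ C N : ℝ, 0 ≤ C ∧ 0 ≤ N ∧ ∀ ξ y,
      ‖iteratedFDeriv ℝ k v (ξ - y) - iteratedFDeriv ℝ k v ξ‖
        ≤ C * (‖y‖ * Real.exp (N * ω ‖y‖)) * Real.exp (-(l * ω ‖ξ‖)) := by
  obtain ⟨L, hL, hadd⟩ := ω.add_le
  have hlL : 0 < l * L := by positivity
  obtain ⟨C, hC0, hC⟩ := hv.exists_bound hlL (k + 1)
  refine ⟨C * Real.exp (l * L), l * L, by positivity, hlL.le, fun ξ y => ?_⟩
  have hdiff : Differentiable ℝ (iteratedFDeriv ℝ k v) :=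
    hv.1.differentiable_iteratedFDeriv (by exact_mod_cast WithTop.coe_lt_top k)
  have h := Convex.norm_image_sub_le_of_norm_fderiv_le (𝕜 := ℝ) (f := iteratedFDeriv ℝ k v)
    (s := Metric.closedBall ξ ‖y‖) (x := ξ) (y := ξ - y)
    (C := C * Real.exp (l * L) * Real.exp (l * L * ω ‖y‖) * Real.exp (-(l * ω ‖ξ‖)))
    (fun x _ => hdiff x) (fun z hz => ?_) (convex_closedBall _ _) (by simp) (by simp)
  · rw [sub_sub_cancel_left, norm_neg] at h
    exact h.trans (le_of_eq (by ring))
  · rw [norm_fderiv_iteratedFDeriv]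
    refine (hC z).trans ?_
    rw [mul_assoc C, mul_assoc C, ← Real.exp_add, ← Real.exp_add]
    refine mul_le_mul_of_nonneg_left (Real.exp_le_exp.2 ?_) hC0
    have h1 := ω.norm_add_le hadd z (ξ - z)
    rw [add_sub_cancel] at h1
    have h2 : ω ‖ξ - z‖ ≤ ω ‖y‖ := ω.monotoneOn (norm_nonneg _) (norm_nonneg _) (by
      rwa [Metric.mem_closedBall, dist_comm, dist_eq_norm] at hz)
    linear_combination l * h1 + l * L * h2

theorem gaussian_sq_eq_smul (ε : ℝ) (x : EuclideanSpace ℝ (Fin d)) :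
    gaussian (ε ^ 2) x = gaussian 1 (ε • x) := by
  rw [gaussian, gaussian, norm_smul, mul_pow, Real.norm_eq_abs, sq_abs]
  push_cast; ring_nf

/-- All derivatives of `e^{-ε² |x|²} - 1` are of order `ε` times a polynomial. -/
theorem exists_norm_iteratedFDeriv_gaussian_sub_one_le (ω : WeightFunction) (d j : ℕ) :
    ∃ C : ℝ, 0 ≤ C ∧ ∀ ε : ℝ, 0 < ε → ε ≤ 1 → ∀ x : EuclideanSpace ℝ (Fin d),
      ‖iteratedFDeriv ℝ j (fun x => gaussian (ε ^ 2) x - 1) x‖ ≤ C * ε * (1 + ‖x‖) ^ 2 := by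
  rcases Nat.eq_zero_or_pos j with rfl | hj
  · refine ⟨1, zero_le_one, fun ε h0 h1 x => ?_⟩
    rw [norm_iteratedFDeriv_zero]
    have h2 : gaussian (ε ^ 2) x = ((Real.exp (-(ε ^ 2 * ‖x‖ ^ 2)) : ℝ) : ℂ) := by
      rw [gaussian]; push_cast; ring_nf
    rw [h2, ← Complex.ofReal_one, ← Complex.ofReal_sub, Complex.norm_real, Real.norm_eq_abs,
      abs_sub_comm, abs_of_nonneg (sub_nonneg.2 (Real.exp_le_one_iff.2
        (neg_nonpos.2 (by positivity))))]
    have h3 := Real.add_one_le_exp (-(ε ^ 2 * ‖x‖ ^ 2))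
    have h4 : ε ^ 2 * ‖x‖ ^ 2 ≤ ε * (1 + ‖x‖) ^ 2 := by
      have hx := norm_nonneg x
      gcongr
      · nlinarith
      · linarith
    linarith
  · obtain ⟨C, hC, h⟩ := (decays_gaussian (d := d) ω one_pos).exists_bound' j
    refine ⟨C, hC, fun ε h0 h1 x => ?_⟩
    have hg : ContDiff ℝ j (gaussian 1 : EuclideanSpace ℝ (Fin d) → ℂ) :=
      (contDiff_gaussian 1).of_le (by exact_mod_cast le_top)
    have h2 : iteratedFDeriv ℝ j (fun x => gaussian (ε ^ 2) x - 1) x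
        = ε ^ j • iteratedFDeriv ℝ j (gaussian 1) (ε • x) := by
      have hg' : ContDiff ℝ j (fun x : EuclideanSpace ℝ (Fin d) => gaussian 1 (ε • x)) :=
        hg.comp (contDiff_const_smul ε)
      have h3 : (fun x : EuclideanSpace ℝ (Fin d) => gaussian (ε ^ 2) x - 1)
          = (fun x => gaussian 1 (ε • x)) - fun _ => 1 :=
        funext fun x => by rw [gaussian_sq_eq_smul]; rfl
      rw [h3, iteratedFDeriv_sub hg' contDiff_const,
        Pi.sub_apply, iteratedFDeriv_const_of_ne hj.ne',
        iteratedFDeriv_comp_const_smul ε hg]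
      simp
    rw [h2, norm_smul, norm_pow, Real.norm_of_nonneg h0.le]
    calc ε ^ j * ‖iteratedFDeriv ℝ j (gaussian 1) (ε • x)‖
        ≤ ε * C := by
          gcongr
          · exact pow_le_of_le_one h0.le h1 hj.ne'
          · exact h _
      _ ≤ ε * C * (1 + ‖x‖) ^ 2 :=
          le_mul_of_one_le_right (by positivity) (one_le_pow₀ (by linarith [norm_nonneg x]))
      _ = _ := by ring

theorem Decays.exists_weighted_mul_gaussian_sub_le {u : EuclideanSpace ℝ (Fin d) → ℂ}
    (hu : Decays ω u) {l : ℝ} (hl : 0 < l) (k : ℕ) :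
    ∃ C : ℝ, ∀ ε : ℝ, 0 < ε → ε ≤ 1 → ∀ x,
      weighted ω l k (fun x => u x * gaussian (ε ^ 2) x - u x) x ≤ C * ε := by
  obtain ⟨C, N, hC, hN, h⟩ := ω.exists_pow_le 2
  choose A hA0 hA using fun i => hu.exists_bound (show 0 < l + N by positivity) i
  choose B hB0 hB using exists_norm_iteratedFDeriv_gaussian_sub_one_le ω d
  refine ⟨∑ i ∈ Finset.range (k + 1), (k.choose i : ℝ) * A i * (B (k - i) * C),
    fun ε h0 h1 x => ?_⟩
  have h2 : (fun x => u x * gaussian (ε ^ 2) x - u x)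
      = fun x => u x * (gaussian (ε ^ 2) x - 1) := by ext x; ring
  have h3 := norm_iteratedFDeriv_mul_le (n := k) (N := ((⊤ : ℕ∞) : WithTop ℕ∞)) hu.1
    ((contDiff_gaussian (ε ^ 2)).sub (contDiff_const (c := 1))) x (by exact_mod_cast le_top)
  unfold weighted
  rw [h2, ← le_div_iff₀ (Real.exp_pos _), div_eq_mul_inv, ← Real.exp_neg]
  refine h3.trans ?_
  rw [mul_assoc, Finset.sum_mul]
  refine Finset.sum_le_sum fun i _ => ?_
  calc _ ≤ (k.choose i : ℝ) * (A i * Real.exp (-((l + N) * ω ‖x‖))) *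
        (B (k - i) * ε * (C * Real.exp (N * ω ‖x‖))) := by
        gcongr
        · exact mul_nonneg (Nat.cast_nonneg _) (mul_nonneg (hA0 _) (Real.exp_pos _).le)
        · exact hA _ x
        · exact (hB _ ε h0 h1 x).trans (mul_le_mul_of_nonneg_left (h _ (norm_nonneg x))
            (mul_nonneg (hB0 _) h0.le))
    _ = (k.choose i : ℝ) * A i * (B (k - i) * C) *
        (ε * (Real.exp (-((l + N) * ω ‖x‖)) * Real.exp (N * ω ‖x‖))) := by ring
    _ = _ := by rw [← Real.exp_add]; ring_nf

/-- Dilation of the Gaussian in the convolution formula for the Fourier transform of a product. -/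
theorem fourier_mul_gaussian (f : SOmega ω d) {ε : ℝ} (hε : 0 < ε)
    (ξ : EuclideanSpace ℝ (Fin d)) :
    fourier (fun x => f x * gaussian (ε ^ 2) x) ξ
      = ∫ η, 𝓕 (gaussian 1) η * fourier f (ξ - (2 * Real.pi * ε) • η) := by
  have hG := gaussian_mem_sOmega (d := d) ω (b := ε ^ 2) (by positivity)
  have h1 : ∀ ζ : EuclideanSpace ℝ (Fin d), 𝓕 (gaussian 1) ζ
      = |(ε ^ d)⁻¹|⁻¹ • 𝓕 (gaussian (ε ^ 2)) (ε • ζ) := by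
    intro ζ
    have h := Measure.integral_comp_smul (volume : Measure (EuclideanSpace ℝ (Fin d)))
      (fun x => Complex.exp (↑(-2 * Real.pi * inner ℝ x ζ) * Complex.I) • gaussian 1 x) ε
    rw [finrank_euclideanSpace_fin] at h
    rw [eq_inv_smul_iff₀ (by positivity), Real.fourier_eq', Real.fourier_eq', ← h]
    congr 1; ext x
    rw [gaussian_sq_eq_smul, inner_smul_left, inner_smul_right]
    simp
  have h2 := Measure.integral_comp_smul (volume : Measure (EuclideanSpace ℝ (Fin d)))
    (fun η => 𝓕 (gaussian (ε ^ 2)) η * fourier f (ξ - (2 * Real.pi) • η)) ε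
  rw [finrank_euclideanSpace_fin, ← inv_smul_eq_iff₀ (by positivity)] at h2
  have h3 : (fun x => f x * gaussian (ε ^ 2) x) = fun x => gaussian (ε ^ 2) x * f x := by
    ext x; ring
  rw [h3, fourier_mul hG.1 f.integrable f.decays.1.continuous
    (integrable_fourierTransform f.decays_fourier), ← h2, ← integral_smul]
  congr 1; ext η
  rw [h1, smul_mul_assoc, smul_smul]

theorem fourier_sub {u v : EuclideanSpace ℝ (Fin d) → ℂ} (hu : Integrable u)
    (hv : Integrable v) : fourier (fun x => u x - v x) = fourier u - fourier v := by
  ext ξ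
  simp only [fourier, Pi.sub_apply, mul_sub]
  exact integral_sub (integrable_fourier_integrand hu ξ) (integrable_fourier_integrand hv ξ)

theorem SOmega.integral_fourierTransform (f : SOmega ω d) :
    ∫ η, 𝓕 (f : EuclideanSpace ℝ (Fin d) → ℂ) η = f 0 := by
  rw [← congrFun f.fourierInv_fourier_eq 0, Real.fourierInv_eq']
  simp

/-- On the Fourier side, multiplication by `e^{-ε² |x|²}` is an average over translations by vectors
of length of order `ε`. -/
theorem exists_weighted_fourier_mul_gaussian_sub_le (f : SOmega ω d) {l : ℝ} (hl : 0 < l)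
    (k : ℕ) :
    ∃ C : ℝ, ∀ ε : ℝ, 0 < ε → ε ≤ 1 → ∀ ξ,
      weighted ω l k (fourier fun x => f x * gaussian (ε ^ 2) x - f x) ξ ≤ C * ε := by
  set γ := SOmega.gaussian ω d one_pos
  have hγ : (gaussian 1 : EuclideanSpace ℝ (Fin d) → ℂ) = γ := rfl
  have hγi := integrable_fourierTransform γ.decays_fourier
  obtain ⟨C, N, hC, hN, h⟩ := f.decays_fourier.exists_norm_iteratedFDeriv_sub_le hl k
  obtain ⟨C', N', hC', hN', h'⟩ := ω.exists_pow_le 1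
  have hint : Integrable fun η : EuclideanSpace ℝ (Fin d) => ‖𝓕 (⇑γ) η‖ *
      Real.exp ((N' + N) * ω ‖(2 * Real.pi) • η‖) := by
    have := (γ.decays_fourier.integrable_weighted (N' + N)).comp_smul
      (show 2 * Real.pi ≠ 0 by positivity)
    simpa only [fourier_eq] using this
  refine ⟨∫ η : EuclideanSpace ℝ (Fin d), ‖𝓕 (⇑γ) η‖ *
    Real.exp ((N' + N) * ω ‖(2 * Real.pi) • η‖) * (C * C'), fun ε h0 h1 ξ => ?_⟩
  have hfγ : Integrable fun x => f x * gaussian (ε ^ 2) x :=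
    (mul_mem_sOmega f.mem (gaussian_mem_sOmega ω (b := ε ^ 2) (by positivity))).1
  have hbdd : ∀ k : ℕ, ∃ C : ℝ, ∀ x, ‖iteratedFDeriv ℝ k (fourier f) x‖ ≤ C := fun k => by
    obtain ⟨C, -, h⟩ := f.decays_fourier.exists_bound' k
    exact ⟨C, h⟩
  obtain ⟨hsm, hD⟩ := iteratedFDeriv_conv (2 * Real.pi * ε) hγi f.decays_fourier.1 hbdd
  have hfour : fourier (fun x => f x * gaussian (ε ^ 2) x)
      = fun ξ => ∫ η, 𝓕 (⇑γ) η * fourier f (ξ - (2 * Real.pi * ε) • η) :=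
    funext (fourier_mul_gaussian f h0)
  have hcont : Continuous (iteratedFDeriv ℝ k (fourier f)) :=
    f.decays_fourier.1.continuous_iteratedFDeriv (by exact_mod_cast le_top)
  obtain ⟨Cb, hCb⟩ := hbdd k
  have hi1 : Integrable fun η =>
      𝓕 (⇑γ) η • iteratedFDeriv ℝ k (fourier f) (ξ - (2 * Real.pi * ε) • η) :=
    hγi.smul_bdd Cb (hcont.comp (by fun_prop)).aestronglyMeasurable
      (ae_of_all _ fun η => hCb _)
  have hdiff : iteratedFDeriv ℝ k (fourier fun x => f x * gaussian (ε ^ 2) x - f x) ξ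
      = ∫ η, 𝓕 (⇑γ) η • (iteratedFDeriv ℝ k (fourier f) (ξ - (2 * Real.pi * ε) • η)
        - iteratedFDeriv ℝ k (fourier f) ξ) := by
    have hγ1 : ∫ η, 𝓕 (⇑γ) η = 1 := by
      rw [γ.integral_fourierTransform, ← hγ]
      simp [gaussian]
    simp only [smul_sub]
    rw [integral_sub hi1 (hγi.smul_const _), integral_smul_const, hγ1, one_smul, ← hD,
      fourier_sub hfγ f.integrable, hfour,
      iteratedFDeriv_sub (hsm.of_le (by exact_mod_cast le_top))
        (f.decays_fourier.1.of_le (by exact_mod_cast le_top)), Pi.sub_apply]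
  unfold weighted
  rw [hdiff, ← le_div_iff₀ (Real.exp_pos _), div_eq_mul_inv, ← Real.exp_neg,
    ← integral_mul_const, ← integral_mul_const]
  refine norm_integral_le_of_norm_le (((hint.mul_const _).mul_const _).mul_const _)
    (ae_of_all _ fun η => ?_)
  rw [norm_smul]
  set y := (2 * Real.pi) • η
  have hy : (2 * Real.pi * ε) • η = ε • y := by rw [smul_smul, mul_comm]
  have hny : ‖ε • y‖ = ε * ‖y‖ := by rw [norm_smul, Real.norm_of_nonneg h0.le]
  have hωy : ω ‖ε • y‖ ≤ ω ‖y‖ := ω.monotoneOn (norm_nonneg _) (norm_nonneg _) (by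
    rw [hny]; exact mul_le_of_le_one_left (norm_nonneg y) h1)
  have hny' : ‖y‖ ≤ C' * Real.exp (N' * ω ‖y‖) := by
    have := h' _ (norm_nonneg y)
    rw [pow_one] at this
    linarith
  rw [hy]
  calc ‖𝓕 (⇑γ) η‖ * ‖iteratedFDeriv ℝ k (fourier f) (ξ - ε • y) - iteratedFDeriv ℝ k (fourier f) ξ‖
      ≤ ‖𝓕 (⇑γ) η‖ * (C * (ε * (C' * Real.exp (N' * ω ‖y‖)) * Real.exp (N * ω ‖y‖)) *
          Real.exp (-(l * ω ‖ξ‖))) := by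
        refine mul_le_mul_of_nonneg_left ((h _ _).trans ?_) (norm_nonneg _)
        rw [hny] at hωy ⊢
        gcongr
    _ = _ := by rw [add_mul, Real.exp_add]; ring

namespace SOmega

/-- Products are dense: `f` is the limit of the products `f · e^{-ε² |x|²}` as `ε → 0`. -/
theorem tendsto_mul_gaussian (f : SOmega ω d) :
    Tendsto (fun n : ℕ => mul f (gaussian ω d (b := (1 / ((n : ℝ) + 1)) ^ 2) (by positivity)))
      atTop (nhds f) := by
  refine (withSeminorms.tendsto_nhds _ _).2 fun i δ hδ => ?_
  have hkey : ∃ C : ℝ, ∀ n : ℕ, seminormFamily ω d i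
      (mul f (gaussian ω d (b := (1 / ((n : ℝ) + 1)) ^ 2) (by positivity)) - f)
        ≤ C * (1 / ((n : ℝ) + 1)) := by
    have h1 : ∀ n : ℕ, 1 / ((n : ℝ) + 1) ≤ 1 := fun n =>
      div_le_one_of_le₀ (by linarith [Nat.cast_nonneg (α := ℝ) n]) (by positivity)
    rcases i with ⟨l, k⟩ | ⟨l, k⟩
    · obtain ⟨C, hC⟩ := f.decays.exists_weighted_mul_gaussian_sub_le l.2 k
      exact ⟨C, fun n => ciSup_le (hC _ (by positivity) (h1 n))⟩
    · obtain ⟨C, hC⟩ := exists_weighted_fourier_mul_gaussian_sub_le f l.2 k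
      exact ⟨C, fun n => ciSup_le (hC _ (by positivity) (h1 n))⟩
  obtain ⟨C, hC⟩ := hkey
  have hlim : Tendsto (fun n : ℕ => C * (1 / ((n : ℝ) + 1))) atTop (nhds 0) := by
    simpa using tendsto_one_div_add_atTop_nhds_zero_nat.const_mul C
  filter_upwards [hlim.eventually_lt_const hδ] with n hn
  exact (hC n).trans_lt hn

/-! ### Compact multiplication operators on `𝓢_ω(ℝ^d)` -/

theorem mul_modulate (t : EuclideanSpace ℝ (Fin d)) (f g : SOmega ω d) :
    mul (modulate t f) g = mul f (modulate t g) := by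
  refine DFunLike.coe_injective (funext fun x => ?_)
  simp only [mul_apply, modulate_apply]
  ring

theorem exists_isCompactOperator_mul_dual_iff (hd : 0 < d) (a : SOmega ω d →L[ℂ] ℂ) :
    (∃ M : SOmega ω d →ₗ[ℂ] SOmega ω d,
      (∀ f h : SOmega ω d, ∫ x, M f x * h x = a (mul f h)) ∧ IsCompactOperator M) ↔ a = 0 := by
  constructor
  · rintro ⟨M, hMa, hM⟩
    have hint : ∀ f h : SOmega ω d, Integrable fun x => f x * h x := fun f h =>
      (mul f h).integrable
    have hM0 : M = 0 := by
      refine eq_zero_of_isCompactOperator_of_modulate hd hM fun t f => ?_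
      rw [← sub_eq_zero]
      refine eq_zero_of_forall_integral_mul_eq_zero fun h => ?_
      calc ∫ x, (M (modulate t f) - modulate t (M f)) x * h x
          = ∫ x, (M (modulate t f) x * h x - M f x * modulate t h x) := by
            congr 1; ext x
            change (M (modulate t f) x - modulate t (M f) x) * h x = _
            rw [modulate_apply, modulate_apply]
            ring
        _ = 0 := by
            rw [integral_sub (hint _ _) (hint _ _), hMa, hMa, mul_modulate, sub_self]
    have hprod : ∀ f h : SOmega ω d, a (mul f h) = 0 := by
      intro f h
      rw [← hMa, hM0]
      change ∫ x, (0 : ℂ) * h x = 0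
      simp
    ext f
    refine tendsto_nhds_unique ((a.continuous.tendsto f).comp f.tendsto_mul_gaussian) ?_
    simp only [Function.comp_def, hprod]
    exact tendsto_const_nhds
  · rintro rfl
    refine ⟨0, fun f h => ?_, isCompactOperator_zero⟩
    change ∫ x, (0 : ℂ) * h x = 0
    simp

theorem exists_isCompactOperator_mul_fun_iff (hd : 0 < d) (a : EuclideanSpace ℝ (Fin d) → ℂ) :
    (∃ M : SOmega ω d →ₗ[ℂ] SOmega ω d,
      (∀ (f : SOmega ω d) (x : EuclideanSpace ℝ (Fin d)), M f x = a x * f x) ∧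
        IsCompactOperator M) ↔ a = 0 := by
  constructor
  · rintro ⟨M, hMa, hM⟩
    have hM0 : M = 0 := by
      refine eq_zero_of_isCompactOperator_of_modulate hd hM fun t f => ?_
      refine DFunLike.coe_injective (funext fun x => ?_)
      rw [modulate_apply, hMa, hMa, modulate_apply]
      ring
    ext x
    have h := hMa (gaussian ω d one_pos) x
    rw [hM0, gaussian_apply] at h
    exact (mul_eq_zero.1 h.symm).resolve_right (gaussian_ne_zero 1 x)
  · rintro rfl
    refine ⟨0, fun f x => ?_, isCompactOperator_zero⟩
    rw [Pi.zero_apply, zero_mul]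
    rfl

end SOmega

end BMT

/-! ### The Schwartz space as the space of the weight `log (1 + t)` -/

/-- The weight function `t ↦ log (1 + t)`, whose space `𝓢_ω(ℝ^d)` is the Schwartz space. -/
def WeightFunction.logWeight : WeightFunction where
  toFun t := Real.log (1 + t)
  nonneg t ht := Real.log_nonneg (by linarith)
  monotoneOn s hs t _ hst := by
    have hs' : 0 ≤ s := hs
    exact Real.log_le_log (by linarith) (by linarith)
  continuousOn := by
    refine ContinuousOn.log (by fun_prop) fun t ht => ?_
    have ht' : 0 ≤ t := ht
    positivity
  doubling := by
    refine ⟨2, by norm_num, fun t ht => ?_⟩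
    have h : Real.log (1 + 2 * t) ≤ Real.log ((1 + t) ^ 2) :=
      Real.log_le_log (by positivity) (by nlinarith)
    rw [Real.log_pow] at h
    push_cast at h
    linarith
  integrableOn := by
    have hint : IntegrableOn (fun t : ℝ => 2 * 2 ^ (1 / 2 : ℝ) * t ^ (-(3 / 2) : ℝ)) (Ioi 1) :=
      (integrableOn_Ioi_rpow_of_lt (by norm_num) one_pos).const_mul _
    refine hint.mono' ?_ ((ae_restrict_iff' measurableSet_Ioi).2 (ae_of_all _ fun t ht => ?_))
    · exact (Measurable.div (Real.measurable_log.comp (by fun_prop))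
        (by fun_prop)).aestronglyMeasurable
    · have ht' : 1 < t := ht
      have h0 : 0 < t := by linarith
      rw [Real.norm_of_nonneg (div_nonneg (Real.log_nonneg (by linarith)) (by positivity))]
      have h1 : Real.log (1 + t) ≤ 2 * 2 ^ (1 / 2 : ℝ) * t ^ (1 / 2 : ℝ) := by
        calc Real.log (1 + t) ≤ Real.log (2 * t) := Real.log_le_log (by linarith) (by linarith)
          _ ≤ (2 * t) ^ (1 / 2 : ℝ) / (1 / 2) := Real.log_le_rpow_div (by linarith) (by norm_num)
          _ = _ := by rw [Real.mul_rpow (by norm_num) h0.le]; ring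
      have h2 : t ^ (-(3 / 2) : ℝ) = t ^ (1 / 2 : ℝ) / t ^ 2 := by
        rw [← Real.rpow_natCast t 2, ← Real.rpow_sub h0]
        norm_num
      rw [h2, mul_div_assoc']
      exact div_le_div₀ (by positivity) h1 (by positivity) (by linarith)
  log_isBigO := by
    refine Asymptotics.IsBigO.of_bound 1 ?_
    filter_upwards [eventually_ge_atTop 1] with t ht
    rw [one_mul, Real.norm_of_nonneg (Real.log_nonneg ht),
      Real.norm_of_nonneg (Real.log_nonneg (by linarith))]
    exact Real.log_le_log (by linarith) (by linarith)
  convexOn := by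
    have hder : ∀ t : ℝ, HasDerivAt (fun t => Real.log (1 + Real.exp t))
        (Real.exp t / (1 + Real.exp t)) t := fun t =>
      ((Real.hasDerivAt_exp t).const_add 1).log (by positivity)
    refine Monotone.convexOn_univ_of_deriv (fun t => (hder t).differentiableAt) ?_
    intro s t hst
    rw [(hder s).deriv, (hder t).deriv, div_le_div_iff₀ (by positivity) (by positivity)]
    have := Real.exp_le_exp.2 hst
    linarith

namespace BMT

open WeightFunction (logWeight)

variable {d : ℕ}

theorem exp_mul_logWeight_le {l : ℝ} {n : ℕ} (hl : l ≤ n) {t : ℝ} (ht : 0 ≤ t) :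
    Real.exp (l * logWeight t) ≤ (1 + t) ^ n := by
  have h : 0 ≤ Real.log (1 + t) := Real.log_nonneg (by linarith)
  calc Real.exp (l * Real.log (1 + t)) ≤ Real.exp (n * Real.log (1 + t)) := by gcongr
    _ = (1 + t) ^ n := by rw [Real.exp_nat_mul, Real.exp_log (by linarith)]

theorem pow_le_exp_mul_logWeight {l : ℝ} {n : ℕ} (hl : n ≤ l) {t : ℝ} (ht : 0 ≤ t) :
    t ^ n ≤ Real.exp (l * logWeight t) := by
  have h : 0 ≤ Real.log (1 + t) := Real.log_nonneg (by linarith)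
  calc t ^ n ≤ (1 + t) ^ n := by gcongr; linarith
    _ = Real.exp (n * Real.log (1 + t)) := by rw [Real.exp_nat_mul, Real.exp_log (by linarith)]
    _ ≤ Real.exp (l * Real.log (1 + t)) := by gcongr

/-- The Fourier transform with kernel `e^{-i t·ξ}` on the Schwartz space. -/
def fourierSchwartz (d : ℕ) :
    𝓢(EuclideanSpace ℝ (Fin d), ℂ) →L[ℂ] 𝓢(EuclideanSpace ℝ (Fin d), ℂ) :=
  (SchwartzMap.compCLMOfContinuousLinearEquiv ℂ (ContinuousLinearEquiv.smulLeft
    (Units.mk0 (2 * Real.pi)⁻¹ (by positivity)))).comp (SchwartzMap.fourierTransformCLM ℂ)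

theorem coe_fourierSchwartz (f : 𝓢(EuclideanSpace ℝ (Fin d), ℂ)) :
    ⇑(fourierSchwartz d f) = fourier f := by
  ext ξ
  have hpi : 2 * Real.pi ≠ 0 := by positivity
  change 𝓕 (f : EuclideanSpace ℝ (Fin d) → ℂ) ((2 * Real.pi)⁻¹ • ξ) = _
  rw [fourier_eq, smul_inv_smul₀ hpi]

theorem exists_weighted_schwartz_le (l : ℝ) (k : ℕ) :
    ∃ (s : Finset (ℕ × ℕ)) (C : ℝ), 0 ≤ C ∧ ∀ (f : 𝓢(EuclideanSpace ℝ (Fin d), ℂ)) x,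
      weighted logWeight l k f x ≤ C * s.sup (schwartzSeminormFamily ℂ _ _) f := by
  refine ⟨Finset.Iic (⌈l⌉₊, k), 2 ^ ⌈l⌉₊, by positivity, fun f x => ?_⟩
  refine le_trans ?_
    (SchwartzMap.one_add_le_sup_seminorm_apply (𝕜 := ℂ) (m := (⌈l⌉₊, k)) le_rfl le_rfl f x)
  rw [weighted, mul_comm]
  gcongr
  exact exp_mul_logWeight_le (Nat.le_ceil l) (norm_nonneg x)

theorem decays_schwartz (f : 𝓢(EuclideanSpace ℝ (Fin d), ℂ)) : Decays logWeight f := by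
  refine ⟨f.smooth ⊤, fun l _ k => ?_⟩
  obtain ⟨s, C, -, h⟩ := exists_weighted_schwartz_le (d := d) l k
  exact ⟨_, forall_mem_range.2 (h f)⟩

namespace SOmega

/-- A Schwartz function as an element of `𝓢_ω(ℝ^d)` for the logarithmic weight. -/
def ofSchwartzₗ (d : ℕ) : 𝓢(EuclideanSpace ℝ (Fin d), ℂ) →ₗ[ℂ] SOmega logWeight d where
  toFun f := ⟨f, f.integrable, decays_schwartz f, by
    rw [← coe_fourierSchwartz]; exact decays_schwartz _⟩
  map_add' _ _ := rfl
  map_smul' _ _ := rfl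

theorem norm_pow_mul_iteratedFDeriv_le_p (f : SOmega logWeight d) (n k : ℕ)
    (x : EuclideanSpace ℝ (Fin d)) :
    ‖x‖ ^ n * ‖iteratedFDeriv ℝ k f x‖ ≤ p ⟨n + 1, by positivity⟩ k f := by
  refine le_trans ?_ (le_ciSup (f.decays.2 (n + 1) (by positivity) k) x)
  rw [weighted, mul_comm]
  gcongr
  exact pow_le_exp_mul_logWeight (by linarith) (norm_nonneg x)

/-- An element of `𝓢_ω(ℝ^d)` for the logarithmic weight as a Schwartz function. -/
def toSchwartzₗ (d : ℕ) : SOmega logWeight d →ₗ[ℂ] 𝓢(EuclideanSpace ℝ (Fin d), ℂ) where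
  toFun f :=
    { toFun := f
      smooth' := f.decays.1
      decay' := fun n k => ⟨_, norm_pow_mul_iteratedFDeriv_le_p f n k⟩ }
  map_add' _ _ := rfl
  map_smul' _ _ := rfl

theorem continuous_ofSchwartzₗ : Continuous (ofSchwartzₗ d) := by
  refine (schwartz_withSeminorms ℂ _ _).continuous_of_isBounded withSeminorms _
    (Seminorm.IsBounded.of_real ?_)
  rintro (⟨l, k⟩ | ⟨l, k⟩)
  · obtain ⟨s, C, -, h⟩ := exists_weighted_schwartz_le (d := d) l k
    exact ⟨s, C, fun f => ciSup_le (h f)⟩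
  · -- The Fourier seminorms are controlled through continuity on the Schwartz space.
    obtain ⟨s, C, hC, h⟩ := exists_weighted_schwartz_le (d := d) l k
    have hcont : Continuous ((s.sup (schwartzSeminormFamily ℂ (EuclideanSpace ℝ (Fin d)) ℂ)).comp
        (fourierSchwartz d).toLinearMap) :=
      (Seminorm.continuous_finsetSup fun i _ =>
        (schwartz_withSeminorms ℂ _ _).continuous_seminorm i).comp (fourierSchwartz d).continuous
    obtain ⟨s', C', -, h'⟩ := Seminorm.bound_of_continuous (schwartz_withSeminorms ℂ _ _) _ hcont
    refine ⟨s', C * C', fun f => ciSup_le fun ξ => ?_⟩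
    have h1 := h (fourierSchwartz d f) ξ
    rw [coe_fourierSchwartz] at h1
    refine h1.trans ?_
    rw [mul_assoc]
    exact mul_le_mul_of_nonneg_left (h' f) hC

theorem continuous_toSchwartzₗ : Continuous (toSchwartzₗ d) := by
  refine withSeminorms.continuous_of_isBounded (schwartz_withSeminorms ℂ _ _) _
    (Seminorm.IsBounded.of_real ?_)
  rintro ⟨n, k⟩
  refine ⟨{Sum.inl (⟨n + 1, by positivity⟩, k)}, 1, fun f => ?_⟩
  rw [Finset.sup_singleton, one_mul]
  exact SchwartzMap.seminorm_le_bound ℂ n k _ (apply_nonneg _ _)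
    (norm_pow_mul_iteratedFDeriv_le_p f n k)

/-- The space `𝓢_ω(ℝ^d)` of the logarithmic weight is the Schwartz space, as a topological vector
space. -/
def equivSchwartz (d : ℕ) : SOmega logWeight d ≃L[ℂ] 𝓢(EuclideanSpace ℝ (Fin d), ℂ) where
  toLinearMap := toSchwartzₗ d
  invFun := ofSchwartzₗ d
  left_inv _ := rfl
  right_inv _ := rfl
  continuous_toFun := continuous_toSchwartzₗ
  continuous_invFun := continuous_ofSchwartzₗ

theorem equivSchwartz_apply (f : SOmega logWeight d) (x : EuclideanSpace ℝ (Fin d)) :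
    equivSchwartz d f x = f x := rfl

/-- The operator on `𝓢_ω(ℝ^d)`, for the logarithmic weight, that corresponds to an operator on the
Schwartz space. -/
def conjSchwartz (M : 𝓢(EuclideanSpace ℝ (Fin d), ℂ) →ₗ[ℂ] 𝓢(EuclideanSpace ℝ (Fin d), ℂ)) :
    SOmega logWeight d →ₗ[ℂ] SOmega logWeight d :=
  ofSchwartzₗ d ∘ₗ M ∘ₗ toSchwartzₗ d

theorem conjSchwartz_apply
    (M : 𝓢(EuclideanSpace ℝ (Fin d), ℂ) →ₗ[ℂ] 𝓢(EuclideanSpace ℝ (Fin d), ℂ))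
    (f : SOmega logWeight d) (x : EuclideanSpace ℝ (Fin d)) :
    conjSchwartz M f x = M (equivSchwartz d f) x := rfl

theorem isCompactOperator_conjSchwartz
    {M : 𝓢(EuclideanSpace ℝ (Fin d), ℂ) →ₗ[ℂ] 𝓢(EuclideanSpace ℝ (Fin d), ℂ)}
    (hM : IsCompactOperator M) : IsCompactOperator (conjSchwartz M) := by
  have h := (hM.comp_clm (equivSchwartz d).toContinuousLinearMap).continuous_comp
    (continuous_ofSchwartzₗ (d := d))
  exact h

end SOmega

/-! ### Compact multiplication operators on the Schwartz space -/

open SOmega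

theorem exists_isCompactOperator_mul_temperedDistribution_iff (hd : 0 < d)
    (a : 𝓢'(EuclideanSpace ℝ (Fin d), ℂ)) :
    (∃ M : 𝓢(EuclideanSpace ℝ (Fin d), ℂ) →ₗ[ℂ] 𝓢(EuclideanSpace ℝ (Fin d), ℂ),
      (∀ f : 𝓢(EuclideanSpace ℝ (Fin d), ℂ),
        SchwartzMap.toTemperedDistributionCLM (EuclideanSpace ℝ (Fin d)) ℂ volume (M f)
          = TemperedDistribution.smulLeftCLM ℂ f a) ∧ IsCompactOperator M) ↔ a = 0 := by
  constructor
  · rintro ⟨M, hMa, hM⟩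
    have hcont : Continuous fun f => a (equivSchwartz d f) :=
      (map_continuous a).comp (equivSchwartz d).continuous
    let b : SOmega logWeight d →L[ℂ] ℂ :=
      { toFun := fun f => a (equivSchwartz d f)
        map_add' := fun f g => by rw [map_add, map_add]
        map_smul' := fun c f => by rw [map_smul, map_smul, RingHom.id_apply]
        cont := hcont }
    have hb : b = 0 := by
      refine (exists_isCompactOperator_mul_dual_iff hd b).1
        ⟨conjSchwartz M, fun f h => ?_, isCompactOperator_conjSchwartz hM⟩
      have h1 := DFunLike.congr_fun (hMa (equivSchwartz d f)) (equivSchwartz d h)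
      rw [SchwartzMap.toTemperedDistributionCLM_apply_apply volume,
        TemperedDistribution.smulLeftCLM_apply_apply] at h1
      have h2 : SchwartzMap.smulLeftCLM ℂ (equivSchwartz d f) (equivSchwartz d h)
          = equivSchwartz d (mul f h) := by
        ext x
        rw [SchwartzMap.smulLeftCLM_apply_apply (equivSchwartz d f).hasTemperateGrowth]
        rfl
      rw [h2] at h1
      refine Eq.trans ?_ h1
      congr 1; ext x
      rw [conjSchwartz_apply, equivSchwartz_apply, smul_eq_mul, mul_comm]
    ext f
    exact DFunLike.congr_fun hb ((equivSchwartz d).symm f)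
  · rintro rfl
    refine ⟨0, fun f => ?_, isCompactOperator_zero⟩
    rw [LinearMap.zero_apply, map_zero, map_zero]

theorem exists_isCompactOperator_schwartz_mul_fun_iff (hd : 0 < d)
    (a : EuclideanSpace ℝ (Fin d) → ℂ) :
    (∃ M : 𝓢(EuclideanSpace ℝ (Fin d), ℂ) →ₗ[ℂ] 𝓢(EuclideanSpace ℝ (Fin d), ℂ),
      (∀ (f : 𝓢(EuclideanSpace ℝ (Fin d), ℂ)) (x : EuclideanSpace ℝ (Fin d)),
        M f x = a x * f x) ∧ IsCompactOperator M) ↔ a = 0 := by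
  constructor
  · rintro ⟨M, hMa, hM⟩
    exact (exists_isCompactOperator_mul_fun_iff hd a).1
      ⟨conjSchwartz M, fun f x => hMa _ x, isCompactOperator_conjSchwartz hM⟩
  · rintro rfl
    refine ⟨0, fun f x => ?_, isCompactOperator_zero⟩
    rw [Pi.zero_apply, zero_mul]
    rfl

end BMT

end

theorem mainTheorem6 (ω : WeightFunction) (d : ℕ) (hd : 0 < d) :
    -- the multiplication operator by an ultradistribution `a ∈ 𝓢_ω'(ℝ^d)`, where `a f ∈ 𝓢_ω'(ℝ^d)`
    -- is given by `⟨a f, h⟩ = ⟨a, f h⟩`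
    (∀ a : BMT.SOmega ω d →L[ℂ] ℂ,
      (∃ M : BMT.SOmega ω d →ₗ[ℂ] BMT.SOmega ω d,
        (∀ f h : BMT.SOmega ω d, ∫ x, M f x * h x = a (BMT.SOmega.mul f h)) ∧
          IsCompactOperator M) ↔ a = 0) ∧
    -- the multiplication operator by a function
    (∀ a : EuclideanSpace ℝ (Fin d) → ℂ,
      (∃ M : BMT.SOmega ω d →ₗ[ℂ] BMT.SOmega ω d,
        (∀ (f : BMT.SOmega ω d) (x : EuclideanSpace ℝ (Fin d)), M f x = a x * f x) ∧
          IsCompactOperator M) ↔ a = 0) ∧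
    -- the same on the Schwartz space
    (∀ a : 𝓢'(EuclideanSpace ℝ (Fin d), ℂ),
      (∃ M : 𝓢(EuclideanSpace ℝ (Fin d), ℂ) →ₗ[ℂ] 𝓢(EuclideanSpace ℝ (Fin d), ℂ),
        (∀ f : 𝓢(EuclideanSpace ℝ (Fin d), ℂ),
          SchwartzMap.toTemperedDistributionCLM (EuclideanSpace ℝ (Fin d)) ℂ volume (M f)
            = TemperedDistribution.smulLeftCLM ℂ f a) ∧
          IsCompactOperator M) ↔ a = 0) ∧
    (∀ a : EuclideanSpace ℝ (Fin d) → ℂ,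
      (∃ M : 𝓢(EuclideanSpace ℝ (Fin d), ℂ) →ₗ[ℂ] 𝓢(EuclideanSpace ℝ (Fin d), ℂ),
        (∀ (f : 𝓢(EuclideanSpace ℝ (Fin d), ℂ)) (x : EuclideanSpace ℝ (Fin d)),
          M f x = a x * f x) ∧
          IsCompactOperator M) ↔ a = 0) :=
  ⟨BMT.SOmega.exists_isCompactOperator_mul_dual_iff hd,
    BMT.SOmega.exists_isCompactOperator_mul_fun_iff hd,
    BMT.exists_isCompactOperator_mul_temperedDistribution_iff hd,
    BMT.exists_isCompactOperator_schwartz_mul_fun_iff hd⟩
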